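/- Let $d\ge1$, $0\le r^*\le d-1$ and $L=r^*+2$ be integers, let $\beta_1,\dots,\beta_L\in\mathbb R$ be distinct, and let $C_\ell^{(p)}$ ($1\le\ell\le L$, $1\le p\le d$) be real numbers such that, for every $p$, $\sum_{\ell=1}^{L}C_\ell^{(p)}\beta_\ell^{r}=\delta_{p,r}$ for all $r\in\{0,\dots,r^*\}\cup\{p+2\lfloor (r^*-p)/2\rfloor+2\}$ if $p\le r^*$, and for all $r\in\{0,\dots,r^*,p\}$ if $p>r^*$. Put $\Gamma_{d+1}=\sum_{\ell}|C^{(d)}_\ell\beta_\ell^{d+1}|$. Let $X'=(X_1',\dots,X_d')$ have independent components, where $X_k'$ is supported on an open interval $\Omega_k$ and has CDF $G_k$ and density $g_k\ge\rho_{\min}>0$ on $\Omega_k$. Let $V=(V_1,\dots,V_d)$ have independent components with finite moments, vanishing odd moments and $\mathbb E[V_k^2]=\sigma^2$, $\sigma>0$. Let $(X_i')_{i\le N}$ and $(V_i)_{i\le N}$, $N\ge1$, be independent i.i.d. samples of $X'$ and of $V$. Fix $x$ with $x_k\in\Omega_k$ for all $k$, and put $E_k=\big(G_k(X_k')-\mathbf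 1_{X_k'\ge x_k}\big)/g_k(X_k')$. For $M_{d+1}>0$, $\mathcal H_{d+1}$ is the set of functions $\mathcal M:\mathbb R^d\to\mathbb R$ with continuous partial derivatives up to order $d$ and $\big|\mathcal M(y)-\sum_{\|\imath\|_1\le d}\frac{\mathcal D^{(\imath)}\mathcal M(z)}{\imath!}(y-z)^{\imath}\big|\le M_{d+1}\|y-z\|^{d+1}$ for all $y,z\in\mathbb R^d$ ($\|\cdot\|$ is the Euclidean norm). Let $\mathcal M\in\mathcal H_{d+1}$ and $\mathcal M^c(x)=\mathcal M(x)-\mathbb E[\mathcal M(X')]$. For $h=(h_1,\dots,h_d)$ with all $h_k>0$, the full emulator is $$\widehat{\mathcal M^c_N}(x)=\frac1N\sum_{i=1}^N\sum_{\ell=1}^{L}\sum_{p=1}^dC_\ell^{(p)}\,\mathcal M(X_i'+\beta_\ell hV_i)\,e_p\Big(\big(\tfrac{G_k(X'_{i,k})-\mathbf 1_{X'_{i,k}\ge x_k}}{g_k(X'_{i,k})\,h_k\sigma^2}V_{i,k}\big)_{k=1}^d\Big),$$ where $hV_i$ is the componentwise product and $e_p$ is the elementary symmetric polynomial of degree $p$.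 Let $K_{1:d}=\inf_Z\mathbb E\big[\|Z\|\prod_{k=1}^dZ_k^2\big]$ over random vectors $Z$ with independent components, $\mathbb E Z_k=0$ and $\mathbb E Z_k^2=1$. Then $\mathcal M(X')$ and the $E_k$ are integrable, $\widehat{\mathcal M^c_N}(x)$ is integrable for all sufficiently small $h$, and the following hold, uniformly in $N$ and in the samples. 1. As $h\to0$ (with all $h_k>0$), $$\big|\mathbb E[\widehat{\mathcal M^c_N}(x)]-\mathcal M^c(x)\big|\le\sigma\|h\|\,M_{d+1}K_{1:d}\Gamma_{d+1}\prod_{k=1}^d\mathbb E|E_k|+O(\|h\|^2).$$ 2. If $V_k\sim\mathcal U(-\xi,\xi)$ for all $k$, with $\xi>0$, then as $h\to0$ $$\big|\mathbb E[\widehat{\mathcal M^c_N}(x)]-\mathcal M^c(x)\big|\le\xi\|h\|_1\,M_{d+1}\Gamma_{d+1}\prod_{k=1}^d\mathbb E|E_k|+O(\|h\|_1^2).$$ 3. If, in 2, moreover $\xi\le\big(d\,M_{d+1}\Gamma_{d+1}\prod_{k}\mathbb E|E_k|\big)^{-1}$, then with a uniform bandwidth $h_k=\eta$ one has $\big|\mathbb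 E[\widehat{\mathcal M^c_N}(x)]-\mathcal M^c(x)\big|\le\eta$ for all sufficiently small $\eta>0$. -/

import Mathlib

open MeasureTheory ProbabilityTheory Filter Topology

universe u

namespace DbAnova

noncomputable section

/-- Vectors of `ℝ^d`, with the Euclidean norm. -/
abbrev Vec (d : ℕ) := EuclideanSpace ℝ (Fin d)

/-- The partial derivative `∂f/∂x_k`. -/
def partialDeriv {d : ℕ} (k : Fin d) (f : Vec d → ℝ) : Vec d → ℝ :=
  fun y => lineDeriv ℝ f y (EuclideanSpace.single k 1)

/-- The cross-partial derivative `D^(i) f = (∏_k ∂^{i_k}/∂x_k^{i_k}) f` of a multi-index `i`. -/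
def multiDeriv {d : ℕ} (i : Fin d → ℕ) (f : Vec d → ℝ) : Vec d → ℝ :=
  (List.finRange d).foldr (fun k F => (partialDeriv k)^[i k] F) f

/-- The Taylor polynomial of `f` at `y`, evaluated at `x`:
the sum of `D^(i) f (y) / i! * (x - y)^i` over the multi-indices with `|i|_1 < α`. -/
def taylorSum {d : ℕ} (α : ℕ) (f : Vec d → ℝ) (y x : Vec d) : ℝ :=
  ∑ n ∈ Finset.range α, ∑ i ∈ Finset.Nat.antidiagonalTuple d n,
    multiDeriv i f y / (∏ k, (Nat.factorial (i k) : ℝ)) * ∏ k, (x k - y k) ^ i k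

/-- `f` lies in the Hölder space `H_α`, with constant `Mα > 0`. A Taylor bound at all pairs of
points already forces the derivatives of order less than `α` to be classical and continuous. -/
structure IsHolder {d : ℕ} (α : ℕ) (Mα : ℝ) (f : Vec d → ℝ) : Prop where
  pos : 0 < Mα
  contDiff : ∀ n : ℕ, n < α → ContDiff ℝ n f
  bound : ∀ x y : Vec d, |f x - taylorSum α f y x| ≤ Mα * ‖x - y‖ ^ α

/-- `ν` is a probability law on `ℝ`, supported on the open interval `I` (bounded or not), with
probability density `g`, and `g ≥ ρmin > 0` on `I`. -/
structure IsInputLaw (ρmin : ℝ) (I : Set ℝ) (g : ℝ → ℝ) (ν : Measure ℝ) : Prop where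
  prob : IsProbabilityMeasure ν
  isOpen : IsOpen I
  interval : I.OrdConnected
  measurable : Measurable g
  density : ν = volume.withDensity (fun y => ENNReal.ofReal (g y))
  support : ∀ y, y ∉ I → g y = 0
  rho_pos : 0 < ρmin
  lower : ∀ y ∈ I, ρmin ≤ g y

/-- `τ` is the law of a variable `V_k` with variance `σ ^ 2`, finite moments, and vanishing odd
moments (in particular, mean zero). -/
structure IsNoiseLaw (σ : ℝ) (τ : Measure ℝ) : Prop where
  prob : IsProbabilityMeasure τ
  moments : ∀ q : ℕ, Integrable (fun v : ℝ => v ^ (2 * q)) τ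
  odd : ∀ q : ℕ, ∫ v, v ^ (2 * q + 1) ∂τ = 0
  var : ∫ v, v ^ 2 ∂τ = σ ^ 2

/-- `E_k` as a function of `y = X'_k`: `(G(y) - 1_{y ≥ t}) / g(y)`, `G` the CDF of `ν`. -/
def kernelE (ν : Measure ℝ) (g : ℝ → ℝ) (t y : ℝ) : ℝ :=
  (cdf ν y - Set.indicator (Set.Ici t) (fun _ => (1 : ℝ)) y) / g y

/-- The expectation of `|E_k|`. -/
def meanAbsE (ν : Measure ℝ) (g : ℝ → ℝ) (t : ℝ) : ℝ := ∫ y, |kernelE ν g t y| ∂ν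

/-- The elementary symmetric polynomial of degree `p` in `r_1, …, r_d`. -/
def elemSymm {d : ℕ} (p : ℕ) (r : Fin d → ℝ) : ℝ :=
  ∑ w ∈ Finset.powersetCard p Finset.univ, ∏ k ∈ w, r k

/-- The constraints on the coefficients `C_ℓ^(p)`, `1 ≤ p ≤ d` (here `C p ℓ`):
`∑_ℓ C_ℓ^(p) β_ℓ^r = δ_{p,r}` for
`r = 0, …, r*, p + 2 λ_p + 2, p + 2 λ_p + 4, …, p + 2 λ_p + 2 (L - 1 - r*)` if `p ≤ r*`, where
`λ_p = ⌊(r* - p) / 2⌋`, and for `r = 0, …, r*, p, p + 2, …, p + 2 (L - r* - 2)` if `p > r*`. -/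
structure IsCoeff (d L rs : ℕ) (β : Fin L → ℝ) (C : ℕ → Fin L → ℝ) : Prop where
  low : ∀ p ∈ Finset.Icc 1 d, ∀ r ≤ rs, ∑ l, C p l * β l ^ r = if p = r then 1 else 0
  high_of_le : ∀ p ∈ Finset.Icc 1 d, p ≤ rs → ∀ m : ℕ, 1 ≤ m → m + rs + 1 ≤ L →
    ∀ r : ℕ, r = p + 2 * ((rs - p) / 2) + 2 * m →
      ∑ l, C p l * β l ^ r = if p = r then 1 else 0
  high_of_gt : ∀ p ∈ Finset.Icc 1 d, rs < p → ∀ m : ℕ, m + rs + 2 ≤ L →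
    ∀ r : ℕ, r = p + 2 * m → ∑ l, C p l * β l ^ r = if p = r then 1 else 0

/-- `Γ_r = ∑_ℓ |C_ℓ^(p) β_ℓ^r|`. -/
def Gam {L : ℕ} (C : ℕ → Fin L → ℝ) (β : Fin L → ℝ) (p r : ℕ) : ℝ := ∑ l, |C p l * β l ^ r|

/-- `K_{1:d}`: the infimum of the expectation of `‖Z‖ ∏_k Z_k²` over the random vectors `Z` with
independent, centered and standardized components (those for which it is finite). -/
def Kconst (d : ℕ) : ℝ :=
  sInf {v : ℝ | ∃ μ : Fin d → Measure ℝ,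
    (∀ k, IsProbabilityMeasure (μ k) ∧ MemLp id 2 (μ k) ∧ ∫ z, z ∂(μ k) = 0 ∧
      ∫ z, z ^ 2 ∂(μ k) = 1) ∧
    Integrable (fun z : Fin d → ℝ => ‖(WithLp.toLp 2 z : Vec d)‖ * ∏ k, z k ^ 2) (Measure.pi μ) ∧
    v = ∫ z, ‖(WithLp.toLp 2 z : Vec d)‖ * ∏ k, z k ^ 2 ∂(Measure.pi μ)}

/-- The centered output `M^c(x) = M(x) - E[M(X')]`, `X'` having independent components of
laws `ν_k`. -/
def centered {d : ℕ} (M : Vec d → ℝ) (ν : Fin d → Measure ℝ) (x : Vec d) : ℝ :=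
  M x - ∫ y, M (WithLp.toLp 2 y) ∂(Measure.pi ν)

/-- Two independent samples `X'_1, …, X'_N` and `V_1, …, V_N` of random vectors whose independent
components have the laws `ν_k` and `τ_k`. -/
structure IsSample {Ω : Type*} [MeasurableSpace Ω] (P : Measure Ω) {d N : ℕ}
    (ν τ : Fin d → Measure ℝ) (X V : Fin N → Fin d → Ω → ℝ) : Prop where
  lawX : ∀ i k, HasLaw (X i k) (ν k) P
  lawV : ∀ i k, HasLaw (V i k) (τ k) P
  indep : iIndepFun (Sum.elim (fun q : Fin N × Fin d => X q.1 q.2)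
    (fun q : Fin N × Fin d => V q.1 q.2)) P

/-- The full emulator of `M^c` at `x`, as a random variable:
`N⁻¹ ∑_i ∑_ℓ ∑_p C_ℓ^(p) M(X'_i + β_ℓ h V_i) e_p(R(x, X'_i, V_i))`, with
`R_k = E_k V_k / (h_k σ²)`. -/
def emulator {Ω : Type*} {d L N : ℕ} (M : Vec d → ℝ) (β : Fin L → ℝ) (C : ℕ → Fin L → ℝ)
    (ν : Fin d → Measure ℝ) (g : Fin d → ℝ → ℝ) (σ : ℝ) (h x : Vec d)
    (X V : Fin N → Fin d → Ω → ℝ) (ω : Ω) : ℝ :=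
  (1 / (N : ℝ)) * ∑ i, ∑ l, ∑ p ∈ Finset.Icc 1 d,
    C p l * M (WithLp.toLp 2 (fun k => X i k ω + β l * h k * V i k ω)) *
      elemSymm p (fun k => kernelE (ν k) (g k) (x k) (X i k ω) / (h k * σ ^ 2) * V i k ω)

/-- For every sample of every size `N ≥ 1`, the emulator at `x` with bandwidths `h` has a finite
expectation, and the absolute value of its bias is at most `b`. -/
def BiasAtMost {d L : ℕ} (M : Vec d → ℝ) (β : Fin L → ℝ) (C : ℕ → Fin L → ℝ)
    (ν τ : Fin d → Measure ℝ) (g : Fin d → ℝ → ℝ) (σ : ℝ) (x h : Vec d) (b : ℝ) : Prop :=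
  ∀ (Ω : Type u) [MeasurableSpace Ω] (P : Measure Ω) [IsProbabilityMeasure P] (N : ℕ)
    (X V : Fin N → Fin d → Ω → ℝ), 0 < N → IsSample P ν τ X V →
    Integrable (emulator M β C ν g σ h x X V) P ∧
    |∫ ω, emulator M β C ν g σ h x X V ω ∂P - centered M ν x| ≤ b

/-- The filter `h → 0` with all bandwidths `h_k` positive. -/
def bandwidths (d : ℕ) : Filter (Vec d) := 𝓝[{h : Vec d | ∀ k, 0 < h k}] 0

end

end DbAnova

/-! The bias is `O(‖h‖²)` for every admissible noise law. Bounds 1 and 2 follow because their linear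
terms are nonnegative, bound 3 because a multiple of `η²` is eventually below `η`.

Expanding `e_p` over the subsets `w` with `p` elements turns each term of the emulator into an
integral against a product law, with one weight per coordinate. For a coordinate in `w`, let `P` be
a primitive of `f`. Averaging over `X'` integrates by parts, `E[E φ(X')] = E[∫_{X'}^x φ]`
(`IsInputLaw.integral_kernelE_mul`), which leaves `(P(x + βhV) - P(X' + βhV)) V / (hσ²)`. As `V` is
centred, `P(z)` may be subtracted from `P(z + βhV)`, and the difference is `βhV ∫₀¹ f(z + βhtV) dt`.
The factor `h` cancels: what remains is `β` times the difference of the values of `f` at `x` and at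
`X'`, perturbed by the noise `βhtV` with `t` uniform, under the tilt `V²/σ²` (`integral_emWeight`).
No derivative of `M` and no negative power of `h` survives. Writing `β(δ_x - ν)` as a density
against the probability `mixLaw` lets `integral_pi_replace` carry the identity to all coordinates.

Now `M` is expanded around the noiseless point. Degree zero gives `β^|w|` times the ANOVA component
of `w` (`integral_triWeight`). Degree one vanishes because the first and third moments of `V` do
(`integral_effNoise_mul_triWeight_eq_zero`). The rest is `O(‖h‖²)`
(`exists_abs_integral_emWeight_sub_le`). Since `∑_ℓ C_ℓ^(p) β_ℓ^p = 1` and the components of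
nonempty `w` add up to `M^c(x)` (`centered_eq_sum`), the main parts sum to the target, which gives
`exists_biasAtMost_sq`. -/

namespace DbAnova

/-! ### Functions with all moments, and polynomial growth -/

/-- `p` has finite absolute moments of all orders under `μ`. -/
structure AllMoments {α : Type*} [MeasurableSpace α] (p : α → ℝ) (μ : Measure α) : Prop where
  meas : AEStronglyMeasurable p μ
  int : ∀ q : ℕ, Integrable (fun a => |p a| ^ q) μ

namespace AllMoments

variable {α γ : Type*} [MeasurableSpace α] [MeasurableSpace γ] {μ : Measure α} {p r : α → ℝ}

lemma mono_ae (hr : AllMoments r μ) (hp : AEStronglyMeasurable p μ)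
    (h : ∀ᵐ a ∂μ, |p a| ≤ |r a|) : AllMoments p μ := by
  refine ⟨hp, fun q => (hr.int q).mono (hp.norm.pow q) ?_⟩
  filter_upwards [h] with a ha
  simp only [Real.norm_eq_abs, abs_pow, abs_abs]
  gcongr

lemma mono (hr : AllMoments r μ) (hp : AEStronglyMeasurable p μ)
    (h : ∀ a, |p a| ≤ |r a|) : AllMoments p μ :=
  hr.mono_ae hp (Eventually.of_forall h)

lemma integrable (h : AllMoments p μ) : Integrable p μ := by
  have := h.int 1
  simp only [pow_one] at this
  exact (integrable_norm_iff h.meas).1 this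

lemma const [IsFiniteMeasure μ] (c : ℝ) : AllMoments (fun _ => c) μ :=
  ⟨aestronglyMeasurable_const, fun _ => integrable_const _⟩

lemma add (hp : AllMoments p μ) (hr : AllMoments r μ) :
    AllMoments (fun a => p a + r a) μ := by
  refine ⟨hp.meas.add hr.meas, fun q => ?_⟩
  refine (((hp.int q).add (hr.int q)).const_mul (2 ^ (q - 1))).mono
    ((hp.meas.add hr.meas).norm.pow q) (Eventually.of_forall fun a => ?_)
  simp only [Pi.add_apply, Real.norm_eq_abs, abs_pow, abs_abs]
  refine le_trans ?_ (le_abs_self _)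
  refine le_trans ?_ (add_pow_le (abs_nonneg (p a)) (abs_nonneg (r a)) q)
  gcongr
  exact abs_add_le _ _

/-- By AM-GM, `|p r|^q ≤ |p|^(2q) + |r|^(2q)`. Asking for all orders at once makes the class an
algebra, so integrability of the products below needs no bookkeeping of exponents. -/
lemma mul (hp : AllMoments p μ) (hr : AllMoments r μ) :
    AllMoments (fun a => p a * r a) μ := by
  refine ⟨hp.meas.mul hr.meas, fun q => ?_⟩
  refine ((hp.int (q * 2)).add (hr.int (q * 2))).mono
    ((hp.meas.mul hr.meas).norm.pow q) (Eventually.of_forall fun a => ?_)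
  simp only [Pi.add_apply, Real.norm_eq_abs, abs_pow, abs_abs, abs_mul, mul_pow]
  refine le_trans ?_ (le_abs_self _)
  rw [pow_mul, pow_mul]
  nlinarith [sq_nonneg (|p a| ^ q - |r a| ^ q), sq_nonneg (|p a| ^ q), sq_nonneg (|r a| ^ q)]

lemma const_mul (hp : AllMoments p μ) (c : ℝ) : AllMoments (fun a => c * p a) μ := by
  refine ⟨hp.meas.const_mul c, fun q => ?_⟩
  simp only [abs_mul, mul_pow]
  exact (hp.int q).const_mul _

lemma sub (hp : AllMoments p μ) (hr : AllMoments r μ) :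
    AllMoments (fun a => p a - r a) μ := by
  simpa [sub_eq_add_neg] using hp.add (hr.const_mul (-1))

lemma abs (hp : AllMoments p μ) : AllMoments (fun a => |p a|) μ :=
  hp.mono hp.meas.norm fun a => by simp

lemma pow [IsFiniteMeasure μ] (hp : AllMoments p μ) (n : ℕ) :
    AllMoments (fun a => p a ^ n) μ := by
  induction n with
  | zero => simpa using const 1
  | succ n ih => simpa [pow_succ] using ih.mul hp

lemma prod [IsFiniteMeasure μ] {ι : Type*} (s : Finset ι) {f : ι → α → ℝ}
    (h : ∀ i ∈ s, AllMoments (f i) μ) : AllMoments (fun a => ∏ i ∈ s, f i a) μ := by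
  classical
  induction s using Finset.induction_on with
  | empty => simpa using const 1
  | insert i s hi ih =>
    simp only [Finset.prod_insert hi]
    exact (h i (by simp)).mul (ih fun j hj => h j (by simp [hj]))

lemma sum [IsFiniteMeasure μ] {ι : Type*} (s : Finset ι) {f : ι → α → ℝ}
    (h : ∀ i ∈ s, AllMoments (f i) μ) : AllMoments (fun a => ∑ i ∈ s, f i a) μ := by
  classical
  induction s using Finset.induction_on with
  | empty => simpa using const 0
  | insert i s hi ih =>
    simp only [Finset.sum_insert hi]
    exact (h i (by simp)).add (ih fun j hj => h j (by simp [hj]))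

lemma comp {π : γ → α} {κ : Measure γ} (hp : AllMoments p μ) (h : MeasurePreserving π κ μ) :
    AllMoments (fun c => p (π c)) κ :=
  ⟨hp.meas.comp_measurePreserving h, fun q => h.integrable_comp_of_integrable (hp.int q)⟩

lemma of_bound_ae [IsFiniteMeasure μ] (hp : AEStronglyMeasurable p μ) (c : ℝ)
    (h : ∀ᵐ a ∂μ, |p a| ≤ c) : AllMoments p μ :=
  (const c).mono_ae hp (h.mono fun _ ha => ha.trans (le_abs_self c))

end AllMoments

/-- A continuous function of several variables of at most polynomial growth. -/
structure PolyGrowth {n : ℕ} (M : (Fin n → ℝ) → ℝ) : Prop where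
  cont : Continuous M
  bound : ∃ (K : ℝ) (q : ℕ), ∀ z, |M z| ≤ K * ∏ k, (1 + |z k|) ^ q

/-- A continuous function of one variable of at most polynomial growth. -/
structure PolyGrowthOne (f : ℝ → ℝ) : Prop where
  cont : Continuous f
  bound : ∃ (K : ℝ) (q : ℕ), ∀ z, |f z| ≤ K * (1 + |z|) ^ q

lemma PolyGrowthOne.allMoments {α : Type*} [MeasurableSpace α] {μ : Measure α}
    [IsFiniteMeasure μ] {f : ℝ → ℝ} (hf : PolyGrowthOne f) {z : α → ℝ} (hz : AllMoments z μ) :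
    AllMoments (fun a => f (z a)) μ := by
  obtain ⟨K, q, hK⟩ := hf.bound
  refine ((((AllMoments.const 1).add hz.abs).pow q).const_mul K).mono
    (hf.cont.comp_aestronglyMeasurable hz.meas) fun a => (hK _).trans (le_abs_self _)

lemma PolyGrowth.allMoments {α : Type*} [MeasurableSpace α] {μ : Measure α}
    [IsFiniteMeasure μ] {n : ℕ} {M : (Fin n → ℝ) → ℝ} (hM : PolyGrowth M) {z : Fin n → α → ℝ}
    (hz : ∀ k, AllMoments (z k) μ) :
    AllMoments (fun a => M (fun k => z k a)) μ := by
  obtain ⟨K, q, hK⟩ := hM.bound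
  refine ((AllMoments.prod Finset.univ fun k _ =>
    ((AllMoments.const 1).add (hz k).abs).pow q).const_mul K).mono
    (hM.cont.comp_aestronglyMeasurable ?_) fun a => (hK _).trans (le_abs_self _)
  exact (aemeasurable_pi_lambda _ fun k => (hz k).meas.aemeasurable).aestronglyMeasurable

/-- The growth bound is a product over the coordinates, so freezing some of them only changes the
constant. -/
lemma PolyGrowth.section_left {n : ℕ} {M : (Fin (n + 1) → ℝ) → ℝ} (hM : PolyGrowth M)
    (y : Fin n → ℝ) : PolyGrowthOne fun t => M (Fin.cons t y) := by
  obtain ⟨K, q, hK⟩ := hM.bound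
  refine ⟨hM.cont.comp (by fun_prop), K * ∏ k, (1 + |y k|) ^ q, q, fun z => ?_⟩
  refine (hK _).trans (le_of_eq ?_)
  rw [Fin.prod_univ_succ]
  simp only [Fin.cons_zero, Fin.cons_succ]
  ring

lemma PolyGrowth.section_right {n : ℕ} {M : (Fin (n + 1) → ℝ) → ℝ} (hM : PolyGrowth M)
    (t : ℝ) : PolyGrowth fun y : Fin n → ℝ => M (Fin.cons t y) := by
  obtain ⟨K, q, hK⟩ := hM.bound
  refine ⟨hM.cont.comp (by fun_prop), K * (1 + |t|) ^ q, q, fun z => ?_⟩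
  refine (hK _).trans (le_of_eq ?_)
  rw [Fin.prod_univ_succ]
  simp only [Fin.cons_zero, Fin.cons_succ]
  ring

lemma allMoments_pi {α : Type*} [MeasurableSpace α] {ι : Type*} [Fintype ι] {μ : ι → Measure α}
    [∀ k, IsProbabilityMeasure (μ k)] {k : ι} {p : α → ℝ} (h : AllMoments p (μ k)) :
    AllMoments (fun ω : ι → α => p (ω k)) (Measure.pi μ) :=
  h.comp (measurePreserving_eval μ k)

lemma allMoments_fst {α γ : Type*} [MeasurableSpace α] [MeasurableSpace γ] {μ : Measure α}
    {κ : Measure γ} [SFinite μ] [IsProbabilityMeasure κ] {p : α → ℝ} (h : AllMoments p μ) :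
    AllMoments (fun ω : α × γ => p ω.1) (μ.prod κ) :=
  h.comp measurePreserving_fst

lemma allMoments_snd {α γ : Type*} [MeasurableSpace α] [MeasurableSpace γ] {μ : Measure α}
    {κ : Measure γ} [SFinite κ] [IsProbabilityMeasure μ] {p : γ → ℝ} (h : AllMoments p κ) :
    AllMoments (fun ω : α × γ => p ω.2) (μ.prod κ) :=
  h.comp measurePreserving_snd

/-! ### Changing a product law coordinate by coordinate -/

lemma integral_pi_succ {δ : Type*} [MeasurableSpace δ] {n : ℕ} (M : (Fin (n + 1) → ℝ) → ℝ)
    (m : Fin (n + 1) → Measure δ) [∀ k, IsProbabilityMeasure (m k)]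
    (y e : Fin (n + 1) → δ → ℝ) :
    ∫ ω, M (fun k => y k (ω k)) * ∏ k, e k (ω k) ∂(Measure.pi m) =
      ∫ ω, M (Fin.cons (y 0 ω.1) fun k => y k.succ (ω.2 k)) *
        (e 0 ω.1 * ∏ k : Fin n, e k.succ (ω.2 k))
        ∂((m 0).prod (Measure.pi fun k : Fin n => m k.succ)) := by
  have h := measurePreserving_piFinSuccAbove m 0
  rw [← (h.symm _).integral_comp']
  congr 1
  funext ω
  have h0 : (MeasurableEquiv.piFinSuccAbove (fun _ : Fin (n + 1) => δ) 0).symm ω =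
      Fin.cons ω.1 ω.2 := by
    simp [MeasurableEquiv.piFinSuccAbove, Fin.insertNthEquiv]
  rw [h0, Fin.prod_univ_succ]
  simp only [Fin.cons_zero, Fin.cons_succ]
  congr 2
  funext k
  refine Fin.cases ?_ (fun j => ?_) k <;> simp

lemma PolyGrowth.integrable_prod_pi {δ δ' : Type*} [MeasurableSpace δ] [MeasurableSpace δ'] {n : ℕ}
    {M : (Fin (n + 1) → ℝ) → ℝ} (hM : PolyGrowth M) (m : Measure δ)
    (m' : Fin n → Measure δ') [IsProbabilityMeasure m] [∀ k, IsProbabilityMeasure (m' k)]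
    {y e : δ → ℝ} {y' e' : Fin n → δ' → ℝ} (hy : AllMoments y m) (he : AllMoments e m)
    (hy' : ∀ k, AllMoments (y' k) (m' k)) (he' : ∀ k, AllMoments (e' k) (m' k)) :
    Integrable (fun ω => M (Fin.cons (y ω.1) fun k => y' k (ω.2 k)) *
      (e ω.1 * ∏ k : Fin n, e' k (ω.2 k))) (m.prod (Measure.pi m')) := by
  refine AllMoments.integrable ?_
  refine AllMoments.mul ?_ ((allMoments_fst he).mul (AllMoments.prod _ fun k _ =>
    allMoments_snd (allMoments_pi (he' k))))
  have := hM.allMoments (μ := m.prod (Measure.pi m'))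
    (z := fun k ω => Fin.cons (α := fun _ => ℝ) (y ω.1) (fun j => y' j (ω.2 j)) k) ?_
  · simpa using this
  · intro k
    refine Fin.cases ?_ (fun j => ?_) k
    · simpa using allMoments_fst hy
    · simpa using allMoments_snd (allMoments_pi (hy' j))

/-- Weighted integrals against a product measure may be changed one coordinate at a time. -/
theorem integral_pi_replace {α γ : Type*} [MeasurableSpace α] [MeasurableSpace γ] {n : ℕ}
    (μ : Fin n → Measure α) (μ' : Fin n → Measure γ)
    [∀ k, IsProbabilityMeasure (μ k)] [∀ k, IsProbabilityMeasure (μ' k)]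
    (z c : Fin n → α → ℝ) (z' c' : Fin n → γ → ℝ)
    (hz : ∀ k, AllMoments (z k) (μ k)) (hc : ∀ k, AllMoments (c k) (μ k))
    (hz' : ∀ k, AllMoments (z' k) (μ' k)) (hc' : ∀ k, AllMoments (c' k) (μ' k))
    (H : ∀ k f, PolyGrowthOne f →
      ∫ a, f (z k a) * c k a ∂(μ k) = ∫ a, f (z' k a) * c' k a ∂(μ' k))
    (M : (Fin n → ℝ) → ℝ) (hM : PolyGrowth M) :
    ∫ ω, M (fun k => z k (ω k)) * ∏ k, c k (ω k) ∂(Measure.pi μ) =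
      ∫ ω, M (fun k => z' k (ω k)) * ∏ k, c' k (ω k) ∂(Measure.pi μ') := by
  induction n with
  | zero =>
    have h (t t' : Fin 0 → ℝ) : M t = M t' := congrArg M (Subsingleton.elim _ _)
    simp [h _ default]
  | succ n ih =>
    have step : ∀ ω : Fin n → α,
        ∫ a, M (Fin.cons (z 0 a) fun k => z k.succ (ω k)) *
          (c 0 a * ∏ k : Fin n, c k.succ (ω k)) ∂(μ 0) =
        ∫ a, M (Fin.cons (z' 0 a) fun k => z k.succ (ω k)) *
          (c' 0 a * ∏ k : Fin n, c k.succ (ω k)) ∂(μ' 0) := by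
      intro ω
      have := H 0 _ (hM.section_left fun k => z k.succ (ω k))
      simp only [← mul_assoc]
      rw [integral_mul_const, integral_mul_const, this]
    have step' : ∀ a : γ,
        ∫ ω, M (Fin.cons (z' 0 a) fun k => z k.succ (ω k)) *
          (c' 0 a * ∏ k : Fin n, c k.succ (ω k)) ∂(Measure.pi fun k : Fin n => μ k.succ) =
        ∫ ω, M (Fin.cons (z' 0 a) fun k => z' k.succ (ω k)) *
          (c' 0 a * ∏ k : Fin n, c' k.succ (ω k)) ∂(Measure.pi fun k : Fin n => μ' k.succ) := by
      intro a
      have := ih (fun k => μ k.succ) (fun k => μ' k.succ) (fun k => z k.succ)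
        (fun k => c k.succ) (fun k => z' k.succ) (fun k => c' k.succ) (fun k => hz _)
        (fun k => hc _) (fun k => hz' _) (fun k => hc' _) (fun k => H _) _
        (hM.section_right (z' 0 a))
      simp only [mul_left_comm _ (c' 0 a)]
      rw [integral_const_mul, integral_const_mul, this]
    -- The intermediate law has the new coordinate `0` and the old other ones. Fubini is used in one
    -- order to make coordinate `0` innermost, then in the other order for the remaining block.
    rw [integral_pi_succ, integral_pi_succ, integral_prod_symm _ (hM.integrable_prod_pi _ _ (y' := fun k => z k.succ) (e' := fun k => c k.succ)
      (hz 0) (hc 0) (fun k => hz _) (fun k => hc _))]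
    simp only [step]
    rw [← integral_prod_symm _ (hM.integrable_prod_pi _ _ (y' := fun k => z k.succ) (e' := fun k => c k.succ)
      (hz' 0) (hc' 0) (fun k => hz _) (fun k => hc _)),
      integral_prod _ (hM.integrable_prod_pi _ _ (y' := fun k => z k.succ) (e' := fun k => c k.succ)
      (hz' 0) (hc' 0) (fun k => hz _) (fun k => hc _))]
    simp only [step']
    rw [← integral_prod _ (hM.integrable_prod_pi _ _ (y' := fun k => z' k.succ) (e' := fun k => c' k.succ)
      (hz' 0) (hc' 0) (fun k => hz' _) (fun k => hc' _))]

/-! ### The input law and integration by parts against the kernel -/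

namespace IsInputLaw

variable {ρ : ℝ} {I : Set ℝ} {g : ℝ → ℝ} {ν : Measure ℝ}

lemma ae_mem (h : IsInputLaw ρ I g ν) : ∀ᵐ y ∂ν, y ∈ I := by
  rw [ae_iff, h.density]
  change (volume.withDensity fun y => ENNReal.ofReal (g y)) Iᶜ = 0
  rw [withDensity_apply _ h.isOpen.measurableSet.compl]
  refine (setLIntegral_congr_fun h.isOpen.measurableSet.compl (g := fun _ => 0) ?_).trans (by simp)
  intro y hy
  simp [h.support y hy]

/-- A density bounded below on `I` has total mass at most one, so `I` has length at most `1 / ρ`.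
This is what bounds `X'` and gives it all moments. -/
lemma volume_mul_le (h : IsInputLaw ρ I g ν) : ENNReal.ofReal ρ * volume I ≤ 1 := by
  have := h.prob
  calc ENNReal.ofReal ρ * volume I = ∫⁻ _ in I, ENNReal.ofReal ρ := by simp
    _ ≤ ∫⁻ y in I, ENNReal.ofReal (g y) :=
      setLIntegral_mono' h.isOpen.measurableSet fun y hy => ENNReal.ofReal_le_ofReal (h.lower y hy)
    _ = ν I := by rw [h.density, withDensity_apply _ h.isOpen.measurableSet]
    _ ≤ 1 := prob_le_one

lemma volume_lt_top (h : IsInputLaw ρ I g ν) : volume I < ⊤ := by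
  refine lt_top_iff_ne_top.2 fun hI => ?_
  have := h.volume_mul_le
  rw [hI, ENNReal.mul_top (by simpa using h.rho_pos)] at this
  simp at this

lemma abs_sub_le (h : IsInputLaw ρ I g ν) {x y : ℝ} (hx : x ∈ I) (hy : y ∈ I) :
    |y - x| ≤ 1 / ρ := by
  have hsub : Set.uIcc x y ⊆ I := h.interval.uIcc_subset hx hy
  have h1 : ENNReal.ofReal ρ * ENNReal.ofReal |y - x| ≤ 1 := by
    rw [← Real.volume_interval]
    exact (mul_le_mul_right (measure_mono hsub) _).trans h.volume_mul_le
  rw [← ENNReal.ofReal_mul h.rho_pos.le, ENNReal.ofReal_le_one] at h1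
  rw [le_div_iff₀ h.rho_pos]
  linarith

lemma abs_le (h : IsInputLaw ρ I g ν) {x y : ℝ} (hx : x ∈ I) (hy : y ∈ I) :
    |y| ≤ |x| + 1 / ρ := by
  have h1 := h.abs_sub_le hx hy
  have h2 := abs_add_le (y - x) x
  rw [sub_add_cancel] at h2
  linarith

lemma measure_singleton (h : IsInputLaw ρ I g ν) (x : ℝ) : ν {x} = 0 := by
  rw [h.density]
  exact withDensity_absolutelyContinuous _ _ (by simp)

lemma allMoments_id (h : IsInputLaw ρ I g ν) {x : ℝ} (hx : x ∈ I) :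
    AllMoments (fun y : ℝ => y) ν := by
  have := h.prob
  exact .of_bound_ae measurable_id.aestronglyMeasurable _ (h.ae_mem.mono fun y hy => h.abs_le hx hy)

lemma measurable_kernelE (h : IsInputLaw ρ I g ν) (x : ℝ) : Measurable (kernelE ν g x) :=
  (((monotone_cdf ν).measurable).sub (measurable_const.indicator measurableSet_Ici)).div
    h.measurable

lemma abs_weight_le (x y : ℝ) :
    |cdf ν y - Set.indicator (Set.Ici x) (fun _ => (1 : ℝ)) y| ≤ 1 := by
  have h0 := cdf_nonneg ν y
  have h1 := cdf_le_one ν y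
  by_cases hy : y ∈ Set.Ici x
  · rw [Set.indicator_of_mem hy, _root_.abs_le]; constructor <;> linarith
  · rw [Set.indicator_of_notMem hy, _root_.abs_le]; constructor <;> linarith

lemma allMoments_kernelE (h : IsInputLaw ρ I g ν) (x : ℝ) : AllMoments (kernelE ν g x) ν := by
  have := h.prob
  refine .of_bound_ae (h.measurable_kernelE x).aestronglyMeasurable (1 / ρ)
    (h.ae_mem.mono fun y hy => ?_)
  have hg := h.lower y hy
  rw [kernelE, abs_div, abs_of_pos (h.rho_pos.trans_le hg)]
  exact div_le_div₀ zero_le_one (abs_weight_le x y) h.rho_pos hg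

/-- The kernel `E` integrates by parts: `E[E(X') φ(X')] = E[∫_{X'}^x φ]`. -/
lemma integral_kernelE_mul (h : IsInputLaw ρ I g ν) {x : ℝ} (hx : x ∈ I) {φ : ℝ → ℝ}
    (hφ : Continuous φ) :
    ∫ y, kernelE ν g x y * φ y ∂ν = ∫ z, (∫ y in z..x, φ y) ∂ν := by
  have := h.prob
  have hfin : IsFiniteMeasure (volume.restrict I) := ⟨by simpa using h.volume_lt_top⟩
  have hI := h.isOpen.measurableSet
  -- `S` links the two sides: averaged over `z` it is the numerator of the kernel at `y`, while for
  -- fixed `z` it is the signed indicator, in `y`, of the interval between `z` and `x`.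
  let S : ℝ → ℝ → ℝ := fun z y => (Set.Ici z).indicator (fun _ => (1 : ℝ)) y -
    (Set.Ici x).indicator (fun _ => (1 : ℝ)) y
  have hS : ∀ y, ∫ z, S z y ∂ν = cdf ν y - Set.indicator (Set.Ici x) (fun _ => (1 : ℝ)) y := by
    intro y
    have h1 : (fun z => (Set.Ici z).indicator (fun _ => (1 : ℝ)) y) =
        (Set.Iic y).indicator fun _ => (1 : ℝ) := by
      funext z; simp [Set.indicator_apply]
    have h2 : Integrable (fun z => (Set.Ici z).indicator (fun _ => (1 : ℝ)) y) ν := by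
      rw [h1]; exact (integrable_const _).indicator measurableSet_Iic
    rw [integral_sub h2 (integrable_const _), h1, integral_indicator_const _ measurableSet_Iic,
      cdf_eq_real]
    simp
  obtain ⟨K, hK⟩ : ∃ K, ∀ y ∈ I, |φ y| ≤ K := by
    obtain ⟨K, hK⟩ := (isCompact_Icc (a := -(|x| + 1 / ρ)) (b := |x| + 1 / ρ)).exists_bound_of_continuousOn
      hφ.continuousOn
    exact ⟨K, fun y hy => hK y (_root_.abs_le.1 (h.abs_le hx hy))⟩
  have hint : Integrable (Function.uncurry fun y z => S z y * φ y)
      ((volume.restrict I).prod ν) := by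
    refine Integrable.of_bound (C := 2 * K) ?_ ?_
    · refine (Measurable.mul ?_ (hφ.measurable.comp measurable_fst)).aestronglyMeasurable
      refine Measurable.sub ?_ ?_
      · have : (fun a : ℝ × ℝ => (Set.Ici a.2).indicator (fun _ => (1 : ℝ)) a.1) =
            {a : ℝ × ℝ | a.2 ≤ a.1}.indicator fun _ => 1 := by
          funext a; simp [Set.indicator_apply]
        rw [this]
        exact measurable_const.indicator (measurableSet_le measurable_snd measurable_fst)
      · exact (measurable_const.indicator measurableSet_Ici).comp measurable_fst
    · have : ∀ᵐ a ∂((volume.restrict I).prod ν), a.1 ∈ I :=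
        Measure.quasiMeasurePreserving_fst.ae (ae_restrict_mem hI)
      filter_upwards [this] with a ha
      have h1 : |S a.2 a.1| ≤ 2 := by
        simp only [S, Set.indicator_apply]
        split_ifs <;> norm_num
      simp only [Function.uncurry, Real.norm_eq_abs, abs_mul]
      exact mul_le_mul h1 (hK _ ha) (abs_nonneg _) (by norm_num)
  calc ∫ y, kernelE ν g x y * φ y ∂ν
      = ∫ y, g y * (kernelE ν g x y * φ y) := by
        conv_lhs => rw [h.density]
        rw [integral_withDensity_eq_integral_toReal_smul
          (by exact h.measurable.ennreal_ofReal) (by simp)]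
        congr 1
        funext y
        have : 0 ≤ g y := by
          by_cases hy : y ∈ I
          · exact h.rho_pos.le.trans (h.lower y hy)
          · rw [h.support y hy]
        rw [ENNReal.toReal_ofReal this, smul_eq_mul, ← h.density]
    -- The density cancels the denominator of the kernel on `I` and vanishes outside `I`.
    _ = ∫ y in I, ∫ z, S z y * φ y ∂ν := by
        rw [← integral_indicator hI]
        congr 1
        funext y
        by_cases hy : y ∈ I
        · have : g y ≠ 0 := (h.rho_pos.trans_le (h.lower y hy)).ne'
          rw [Set.indicator_of_mem hy, integral_mul_const, hS, kernelE]
          field_simp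
        · rw [Set.indicator_of_notMem hy, h.support y hy, zero_mul]
    _ = ∫ z, (∫ y in I, S z y * φ y) ∂ν := integral_integral_swap hint
    _ = ∫ z, (∫ y in z..x, φ y) ∂ν := by
        refine integral_congr_ae (h.ae_mem.mono fun z hz => ?_)
        rcases le_total z x with hzx | hzx
        · have h1 : (fun y => S z y * φ y) = (Set.Ico z x).indicator φ := by
            funext y
            simp only [S, Set.indicator_apply, Set.mem_Ici, Set.mem_Ico]
            by_cases h1 : z ≤ y <;> by_cases h2 : x ≤ y <;> simp [h1, h2]
            exact absurd (hzx.trans h2) h1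
          have h2 : Set.Ico z x ⊆ I := Set.Ico_subset_Icc_self.trans (h.interval.out hz hx)
          simp only [h1]
          rw [integral_indicator measurableSet_Ico, Measure.restrict_restrict measurableSet_Ico,
            Set.inter_eq_left.2 h2, intervalIntegral.integral_of_le hzx,
            integral_Ico_eq_integral_Ioc]
        · have h1 : (fun y => S z y * φ y) = (Set.Ico x z).indicator (fun y => -φ y) := by
            funext y
            simp only [S, Set.indicator_apply, Set.mem_Ici, Set.mem_Ico]
            by_cases h1 : z ≤ y <;> by_cases h2 : x ≤ y <;> simp [h1, h2]
            exact absurd (hzx.trans h1) h2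
          have h2 : Set.Ico x z ⊆ I := Set.Ico_subset_Icc_self.trans (h.interval.out hx hz)
          simp only [h1]
          rw [integral_indicator measurableSet_Ico, Measure.restrict_restrict measurableSet_Ico,
            Set.inter_eq_left.2 h2, intervalIntegral.integral_of_ge hzx, integral_neg,
            integral_Ico_eq_integral_Ioc]

end IsInputLaw

/-! ### Moments of the noise -/

namespace IsNoiseLaw

variable {σ : ℝ} {τ : Measure ℝ}

lemma allMoments_id (h : IsNoiseLaw σ τ) : AllMoments (fun v : ℝ => v) τ := by
  have := h.prob
  refine ⟨measurable_id.aestronglyMeasurable, fun q => ?_⟩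
  refine ((integrable_const (1 : ℝ)).add (h.moments q)).mono
    (measurable_id.norm.pow_const q).aestronglyMeasurable (Eventually.of_forall fun v => ?_)
  simp only [Pi.add_apply, Real.norm_eq_abs, abs_pow, abs_abs]
  refine le_trans ?_ (le_abs_self _)
  rw [mul_comm 2 q, pow_mul, ← sq_abs (v ^ q), abs_pow]
  nlinarith [sq_nonneg (|v| ^ q - 1), sq_nonneg (|v| ^ q)]

end IsNoiseLaw

/-! ### The transformed law of one coordinate -/

/-- The even mixture of the law `ν` and the unit mass at `x`. -/
noncomputable def mixLaw (ν : Measure ℝ) (x : ℝ) : Measure ℝ :=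
  (2⁻¹ : ENNReal) • ν + (2⁻¹ : ENNReal) • Measure.dirac x

/-- The uniform law on `(0, 1]`. -/
noncomputable def unitLaw : Measure ℝ := volume.restrict (Set.Ioc 0 1)

/-- The law of an evaluation point, a noise variable and an independent uniform variable. -/
noncomputable def triLaw (ν τ : Measure ℝ) (x : ℝ) : Measure (ℝ × ℝ × ℝ) :=
  (mixLaw ν x).prod (τ.prod unitLaw)

/-- The density of `b (δ_x - ν)` (if `s`) or of `ν` (if not) with respect to `mixLaw ν x`. -/
noncomputable def pointWeight (s : Bool) (b x z : ℝ) : ℝ :=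
  if z = x then (if s then 2 * b else 0) else (if s then -(2 * b) else 2)

/-- The weight that tilts the noise: `v² / σ²` if `s`, and `1` if not. -/
noncomputable def noiseWeight (s : Bool) (σ : ℝ) (u : ℝ × ℝ) : ℝ :=
  if s then u.1 ^ 2 / σ ^ 2 else 1

/-- The effective noise: damped by the uniform variable if `s`. -/
def effNoise (s : Bool) (u : ℝ × ℝ) : ℝ := if s then u.2 * u.1 else u.1

/-- The weight that multiplies `M(X' + β h V)` in one coordinate of a term of the emulator. -/
noncomputable def emWeight (s : Bool) (ν : Measure ℝ) (g : ℝ → ℝ) (σ h x : ℝ) (a : ℝ × ℝ) : ℝ :=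
  if s then kernelE ν g x a.1 / (h * σ ^ 2) * a.2 else 1

instance (ν : Measure ℝ) [IsProbabilityMeasure ν] (x : ℝ) :
    IsProbabilityMeasure (mixLaw ν x) :=
  ⟨by simp [mixLaw, ENNReal.inv_two_add_inv_two]⟩

instance : IsProbabilityMeasure unitLaw := ⟨by simp [unitLaw]⟩

instance (ν τ : Measure ℝ) [IsProbabilityMeasure ν] [IsProbabilityMeasure τ] (x : ℝ) :
    IsProbabilityMeasure (triLaw ν τ x) := by
  unfold triLaw; infer_instance

lemma AllMoments.mixLaw {ν : Measure ℝ} {p : ℝ → ℝ} (hp : AllMoments p ν) (x : ℝ) :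
    AllMoments p (mixLaw ν x) := by
  refine ⟨(hp.meas.smul_measure _).add_measure (aestronglyMeasurable_dirac.smul_measure _),
    fun q => ?_⟩
  exact ((hp.int q).smul_measure (by simp)).add_measure
    ((integrable_dirac (by simp [enorm_lt_top])).smul_measure (by simp))

lemma integral_mixLaw {ν : Measure ℝ} {F : ℝ → ℝ} (hF : Integrable F ν) (x : ℝ) :
    ∫ z, F z ∂(mixLaw ν x) = (∫ z, F z ∂ν + F x) / 2 := by
  rw [mixLaw, integral_add_measure (hF.smul_measure (by simp))
    ((integrable_dirac (by simp [enorm_lt_top])).smul_measure (by simp)),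
    integral_smul_measure, integral_smul_measure, integral_dirac]
  simp only [ENNReal.toReal_inv, ENNReal.toReal_ofNat, smul_eq_mul]
  ring

lemma measurable_pointWeight (s : Bool) (b x : ℝ) : Measurable (pointWeight s b x) :=
  Measurable.ite (measurableSet_singleton x) measurable_const measurable_const

lemma abs_pointWeight_le (s : Bool) (b x z : ℝ) : |pointWeight s b x z| ≤ 2 + 2 * |b| := by
  have := abs_nonneg b
  unfold pointWeight
  split_ifs <;> (simp [abs_mul]; try linarith)

lemma allMoments_pointWeight {ν : Measure ℝ} [IsFiniteMeasure ν] (s : Bool) (b x : ℝ) :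
    AllMoments (pointWeight s b x) ν :=
  .of_bound_ae (measurable_pointWeight s b x).aestronglyMeasurable (2 + 2 * |b|)
    (Eventually.of_forall (abs_pointWeight_le s b x))

/-- As `x` is a null point of `ν`, the weight can take separate values on the atom and on the `ν`
part of the mixture; its factors `2` undo the mixing probabilities. -/
lemma integral_mul_pointWeight {ν : Measure ℝ} [IsFiniteMeasure ν] {x : ℝ} (hx : ν {x} = 0)
    {F : ℝ → ℝ} (hF : Integrable F ν) (s : Bool) (b : ℝ) :
    ∫ z, F z * pointWeight s b x z ∂(mixLaw ν x) =
      if s then b * (F x - ∫ z, F z ∂ν) else ∫ z, F z ∂ν := by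
  rw [integral_mixLaw (hF.mul_bdd (c := 2 + 2 * |b|) (measurable_pointWeight s b x).aestronglyMeasurable
    (Eventually.of_forall (abs_pointWeight_le s b x)))]
  have h : ∀ᵐ z ∂ν, z ≠ x := by rw [ae_iff]; simpa using hx
  have h1 : ∫ z, F z * pointWeight s b x z ∂ν = (if s then -(2 * b) else 2) * ∫ z, F z ∂ν := by
    rw [← integral_const_mul]
    refine integral_congr_ae (h.mono fun z hz => ?_)
    simp only [pointWeight, hz, if_false]
    ring
  rw [h1]
  cases s <;> (simp [pointWeight]; try ring)

/-- Integration over an interval of length `|y|` costs one more power of `1 + |y|`. -/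
lemma PolyGrowthOne.primitive {f : ℝ → ℝ} (hf : PolyGrowthOne f) :
    PolyGrowthOne fun y => ∫ t in (0 : ℝ)..y, f t := by
  obtain ⟨K, q, hK⟩ := hf.bound
  refine ⟨intervalIntegral.continuous_primitive (fun a b => hf.cont.intervalIntegrable a b) 0,
    K, q + 1, fun y => ?_⟩
  have hK0 : 0 ≤ K := by simpa using (abs_nonneg _).trans (hK 0)
  have h := intervalIntegral.norm_integral_le_of_norm_le_const (a := 0) (b := y) (f := f)
    (C := K * (1 + |y|) ^ q) fun t ht => (hK t).trans (by
      have : |t| ≤ |y| := by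
        have := Set.abs_sub_left_of_mem_uIcc (Set.uIoc_subset_uIcc ht)
        simpa using this
      gcongr)
  rw [sub_zero, Real.norm_eq_abs] at h
  refine h.trans ?_
  rw [pow_succ, mul_assoc]
  gcongr
  linarith

section Coordinate

variable {ρ σ : ℝ} {I : Set ℝ} {g : ℝ → ℝ} {ν τ : Measure ℝ} {x : ℝ}

lemma allMoments_unit : AllMoments (fun t : ℝ => t) unitLaw :=
  .of_bound_ae measurable_id.aestronglyMeasurable 1 <|
    (ae_restrict_mem measurableSet_Ioc).mono fun t ht => abs_le.2 ⟨by linarith [ht.1], ht.2⟩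

lemma IsNoiseLaw.allMoments_effNoise (hτ : IsNoiseLaw σ τ) (s : Bool) :
    AllMoments (effNoise s) (τ.prod unitLaw) := by
  have := hτ.prob
  have h1 := allMoments_fst (κ := unitLaw) hτ.allMoments_id
  have h2 := allMoments_snd (μ := τ) allMoments_unit
  cases s
  · exact h1
  · exact h2.mul h1

lemma IsNoiseLaw.allMoments_noiseWeight (hτ : IsNoiseLaw σ τ) (s : Bool) :
    AllMoments (noiseWeight s σ) (τ.prod unitLaw) := by
  have := hτ.prob
  have h1 := allMoments_fst (κ := unitLaw) hτ.allMoments_id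
  cases s
  · exact .const 1
  · convert (h1.pow 2).const_mul ((σ ^ 2)⁻¹) using 2
    simp [noiseWeight, div_eq_inv_mul]

lemma IsNoiseLaw.integral_noiseWeight (hσ : 0 < σ) (hτ : IsNoiseLaw σ τ) (s : Bool) :
    ∫ u, noiseWeight s σ u ∂(τ.prod unitLaw) = 1 := by
  have := hτ.prob
  cases s
  · simp [noiseWeight]
  · have h := integral_prod_mul (μ := τ) (ν := unitLaw) (fun b => b ^ 2 / σ ^ 2) fun _ => (1 : ℝ)
    rw [integral_div, hτ.var, div_self (by positivity)] at h
    simpa [noiseWeight] using h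

/-- Without the tilt this is the mean of the noise. With it, the uniform variable factors out and
the third moment over `σ²` remains. -/
lemma IsNoiseLaw.integral_effNoise (hτ : IsNoiseLaw σ τ) (s : Bool) :
    ∫ u, effNoise s u * noiseWeight s σ u ∂(τ.prod unitLaw) = 0 := by
  have := hτ.prob
  cases s
  · have h := integral_prod_mul (μ := τ) (ν := unitLaw) (fun b => b) fun _ => (1 : ℝ)
    have h0 := hτ.odd 0
    simp only [mul_zero, zero_add, pow_one] at h0
    simpa [noiseWeight, effNoise, h0] using h
  · have h := integral_prod_mul (μ := τ) (ν := unitLaw) (fun b => b ^ 3 / σ ^ 2) fun t => t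
    rw [integral_div, hτ.odd 1, zero_div, zero_mul] at h
    rw [← h]
    congr 1
    funext u
    simp only [effNoise, noiseWeight, if_true]
    ring

/-- The integral over the noise factors out of functions of the evaluation point. -/
lemma integral_triLaw [IsProbabilityMeasure ν] [IsProbabilityMeasure τ]
    (F : ℝ → ℝ) (r : ℝ × ℝ → ℝ) :
    ∫ ω, F ω.1 * r ω.2 ∂(triLaw ν τ x) =
      (∫ z, F z ∂(mixLaw ν x)) * ∫ u, r u ∂(τ.prod unitLaw) :=
  integral_prod_mul F r

/-- In one coordinate, the emulator's kernel turns `f(X' + β h V)` into a difference between the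
values of `f` near `x` and near an independent copy of `X'`. -/
lemma integral_emWeight (hν : IsInputLaw ρ I g ν) (hx : x ∈ I) (hσ : 0 < σ)
    (hτ : IsNoiseLaw σ τ) {h : ℝ} (hh : 0 < h) (b : ℝ) (s : Bool) {f : ℝ → ℝ}
    (hf : PolyGrowthOne f) :
    ∫ a, f (a.1 + b * h * a.2) * emWeight s ν g σ h x a ∂(ν.prod τ) =
      ∫ ω, f (ω.1 + b * h * effNoise s ω.2) * (pointWeight s b x ω.1 * noiseWeight s σ ω.2)
        ∂(triLaw ν τ x) := by
  have := hν.prob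
  have := hτ.prob
  have hX := hν.allMoments_id hx
  have hV := hτ.allMoments_id
  have hν0 := hν.measure_singleton x
  have hX' := hX.mixLaw x
  have hmix : ∀ r : ℝ → ℝ, PolyGrowthOne r → Integrable
      (fun ω : ℝ × ℝ × ℝ => r (ω.1 + b * h * effNoise s ω.2) *
        (pointWeight s b x ω.1 * noiseWeight s σ ω.2)) ((mixLaw ν x).prod (τ.prod unitLaw)) :=
    fun r hr => ((hr.allMoments ((allMoments_fst hX').add
      ((allMoments_snd (hτ.allMoments_effNoise s)).const_mul _))).mul
      ((allMoments_fst (allMoments_pointWeight s b x)).mul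
      (allMoments_snd (hτ.allMoments_noiseWeight s)))).integrable
  have hG : Integrable (fun z : ℝ =>
      ∫ u, f (z + b * h * effNoise s u) * noiseWeight s σ u ∂(τ.prod unitLaw)) ν :=
    Integrable.integral_prod_left (f := fun ω : ℝ × ℝ × ℝ =>
      f (ω.1 + b * h * effNoise s ω.2) * noiseWeight s σ ω.2)
      ((hf.allMoments ((allMoments_fst hX).add
      ((allMoments_snd (hτ.allMoments_effNoise s)).const_mul _))).mul
      (allMoments_snd (hτ.allMoments_noiseWeight s))).integrable
  have hR : ∫ ω, f (ω.1 + b * h * effNoise s ω.2) *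
      (pointWeight s b x ω.1 * noiseWeight s σ ω.2) ∂(triLaw ν τ x) =
      ∫ z, (∫ u, f (z + b * h * effNoise s u) * noiseWeight s σ u ∂(τ.prod unitLaw)) *
        pointWeight s b x z ∂(mixLaw ν x) := by
    rw [triLaw, integral_prod _ (hmix f hf)]
    congr 1
    funext z
    rw [← integral_mul_const]
    congr 1
    funext u
    ring
  rw [hR, integral_mul_pointWeight hν0 hG]
  cases s
  · have hi : Integrable (fun a : ℝ × ℝ => f (a.1 + b * h * a.2)) (ν.prod τ) :=
      (hf.allMoments ((allMoments_fst hX).add ((allMoments_snd hV).const_mul _))).integrable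
    simp only [emWeight, effNoise, noiseWeight, Bool.false_eq_true, if_false, mul_one]
    rw [integral_prod _ hi]
    congr 1
    funext z
    have := integral_prod_mul (μ := τ) (ν := unitLaw) (fun v => f (z + b * h * v))
      fun _ => (1 : ℝ)
    simpa using this.symm
  · let P : ℝ → ℝ := fun y => ∫ t in (0 : ℝ)..y, f t
    have hP : PolyGrowthOne P := hf.primitive
    let H : ℝ → ℝ := fun z => ∫ v, P (z + b * h * v) * (v / (h * σ ^ 2)) ∂τ
    have hPi : ∀ z, Integrable (fun v => P (z + b * h * v) * (v / (h * σ ^ 2))) τ := by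
      intro z
      simp only [div_eq_inv_mul]
      exact ((hP.allMoments ((AllMoments.const z).add (hV.const_mul _))).mul
        (hV.const_mul _)).integrable
    have hPj : Integrable (fun a : ℝ × ℝ => P (a.1 + b * h * a.2) * (a.2 / (h * σ ^ 2)))
        (ν.prod τ) := by
      simp only [div_eq_inv_mul]
      exact ((hP.allMoments ((allMoments_fst hX).add ((allMoments_snd hV).const_mul _))).mul
        ((allMoments_snd hV).const_mul _)).integrable
    have hH : Integrable H ν := hPj.integral_prod_left
    have hV0 : ∫ v, v ∂τ = 0 := by simpa using hτ.odd 0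
    -- Since `V` has mean zero, `P z` can be subtracted inside `H z`. The increment `P (z + bhv) - P
    -- z` supplies a factor `bhv`, which turns `v / (hσ²)` into `b v² / σ²`: the bandwidth cancels
    -- and the tilt appears.
    have hG' : ∀ z, b * ∫ u, f (z + b * h * effNoise true u) * noiseWeight true σ u
        ∂(τ.prod unitLaw) = H z := by
      intro z
      have hi : Integrable (fun u : ℝ × ℝ =>
          f (z + b * h * effNoise true u) * noiseWeight true σ u) (τ.prod unitLaw) :=
        ((hf.allMoments ((AllMoments.const z).add
          ((hτ.allMoments_effNoise true).const_mul _))).mul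
          (hτ.allMoments_noiseWeight true)).integrable
      have hP0 : Integrable (fun v => P z * (v / (h * σ ^ 2))) τ :=
        (hV.integrable.div_const _).const_mul _
      have h0 : ∫ v, P z * (v / (h * σ ^ 2)) ∂τ = 0 := by
        rw [integral_const_mul, integral_div, hV0, zero_div, mul_zero]
      rw [integral_prod _ hi, ← integral_const_mul, ← sub_zero (H z), ← h0,
        ← integral_sub (hPi z) hP0]
      congr 1
      funext v
      have h1 : ∫ t, f (z + b * h * effNoise true (v, t)) ∂unitLaw =
          ∫ t in (0 : ℝ)..1, f (z + b * h * v * t) := by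
        rw [intervalIntegral.integral_of_le zero_le_one, unitLaw]
        simp only [effNoise, if_true]
        congr 1
        funext t
        ring_nf
      have h2 : b * h * v * ∫ t in (0 : ℝ)..1, f (z + b * h * v * t) =
          P (z + b * h * v) - P z := by
        rw [intervalIntegral.mul_integral_comp_add_mul]
        simp only [mul_zero, add_zero, mul_one]
        exact (intervalIntegral.integral_interval_sub_left
          (hf.cont.intervalIntegrable _ _) (hf.cont.intervalIntegrable _ _)).symm
      simp only [noiseWeight, if_true]
      rw [integral_mul_const, h1, ← sub_mul, ← h2]
      field_simp
    -- With the noise frozen at `v`, integration by parts in the input replaces `f` by increments of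
    -- its primitive.
    have hL : ∀ v, ∫ y, f (y + b * h * v) * emWeight true ν g σ h x (y, v) ∂ν =
        ∫ z, (P (x + b * h * v) - P (z + b * h * v)) * (v / (h * σ ^ 2)) ∂ν := by
      intro v
      have h1 := hν.integral_kernelE_mul hx (φ := fun y => f (y + b * h * v))
        (hf.cont.comp (by fun_prop))
      have h2 : ∀ z, ∫ y in z..x, f (y + b * h * v) =
          P (x + b * h * v) - P (z + b * h * v) := by
        intro z
        rw [intervalIntegral.integral_comp_add_right]
        exact (intervalIntegral.integral_interval_sub_left
          (hf.cont.intervalIntegrable _ _) (hf.cont.intervalIntegrable _ _)).symm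
      simp only [h2] at h1
      rw [integral_mul_const, ← h1, ← integral_mul_const]
      congr 1
      funext y
      simp only [emWeight, if_true]
      ring
    have hi : Integrable (fun a : ℝ × ℝ =>
        f (a.1 + b * h * a.2) * emWeight true ν g σ h x a) (ν.prod τ) := by
      simp only [emWeight, if_true, div_eq_inv_mul]
      exact ((hf.allMoments ((allMoments_fst hX).add ((allMoments_snd hV).const_mul _))).mul
        (((allMoments_fst (hν.allMoments_kernelE x)).const_mul _).mul
        (allMoments_snd hV))).integrable
    have hj : Integrable (Function.uncurry fun v z : ℝ =>
        (P (x + b * h * v) - P (z + b * h * v)) * (v / (h * σ ^ 2))) (τ.prod ν) := by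
      simp only [Function.uncurry_def, div_eq_inv_mul]
      exact (((hP.allMoments ((AllMoments.const x).add ((allMoments_fst hV).const_mul _))).sub
        (hP.allMoments ((allMoments_snd hX).add ((allMoments_fst hV).const_mul _)))).mul
        ((allMoments_fst hV).const_mul _)).integrable
    rw [integral_prod_symm _ hi]
    simp only [hL, if_true]
    rw [integral_integral_swap hj, mul_sub, hG' x, ← integral_const_mul]
    simp only [hG']
    have h3 : ∀ z, ∫ v, (P (x + b * h * v) - P (z + b * h * v)) * (v / (h * σ ^ 2)) ∂τ =
        H x - H z := by
      intro z
      simp only [sub_mul]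
      exact integral_sub (hPi x) (hPi z)
    simp only [h3]
    rw [integral_sub (integrable_const _) hH]
    simp

end Coordinate

/-! ### Taylor expansion and growth of Hölder functions -/

lemma contDiff_partialDeriv {d n : ℕ} {f : Vec d → ℝ} (hf : ContDiff ℝ (n + 1 : ℕ) f)
    (k : Fin d) : ContDiff ℝ n (partialDeriv k f) := by
  have h : partialDeriv k f = fun y => fderiv ℝ f y (EuclideanSpace.single k 1) := by
    funext y
    exact (hf.differentiable (by simp)).differentiableAt.lineDeriv_eq_fderiv
  rw [h]
  exact (hf.fderiv_right (m := n) (by simp)).clm_apply contDiff_const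

lemma contDiff_partialDeriv_iterate {d n : ℕ} (k : Fin d) (j : ℕ) {f : Vec d → ℝ}
    (hf : ContDiff ℝ (n + j : ℕ) f) : ContDiff ℝ n ((partialDeriv k)^[j] f) := by
  induction j generalizing f with
  | zero => exact hf
  | succ j ih => exact ih (contDiff_partialDeriv hf k)

lemma contDiff_multiDeriv {d n : ℕ} (i : Fin d → ℕ) {f : Vec d → ℝ}
    (hf : ContDiff ℝ (n + ∑ k, i k : ℕ) f) : ContDiff ℝ n (multiDeriv i f) := by
  have h (l : List (Fin d)) : ∀ n : ℕ, ContDiff ℝ (n + (l.map i).sum : ℕ) f →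
      ContDiff ℝ n (l.foldr (fun k F => (partialDeriv k)^[i k] F) f) := by
    induction l with
    | nil => intro n hn; simpa using hn
    | cons k l ih =>
      intro n hn
      refine contDiff_partialDeriv_iterate k (i k) (ih _ ?_)
      simpa [add_assoc] using hn
  exact h _ n (by rwa [← Fin.sum_univ_def])

lemma multiDeriv_zero {d : ℕ} (f : Vec d → ℝ) : multiDeriv 0 f = f := by
  unfold multiDeriv
  induction List.finRange d with
  | nil => rfl
  | cons k l _ => simp

lemma norm_le_sum_abs {d : ℕ} (v : Vec d) : ‖v‖ ≤ ∑ k, |v k| := by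
  rw [EuclideanSpace.norm_eq, Real.sqrt_le_iff]
  exact ⟨Finset.sum_nonneg fun _ _ => abs_nonneg _,
    Finset.sum_sq_le_sq_sum_of_nonneg fun _ _ => abs_nonneg _⟩

lemma sum_abs_le_prod {d : ℕ} (v : Fin d → ℝ) : ∑ k, |v k| ≤ ∏ k, (1 + |v k|) := by
  have h : ∀ s : Finset (Fin d), 1 + ∑ k ∈ s, |v k| ≤ ∏ k ∈ s, (1 + |v k|) := by
    intro s
    induction s using Finset.induction_on with
    | empty => simp
    | insert k s hk ih =>
      rw [Finset.sum_insert hk, Finset.prod_insert hk]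
      have h0 : 0 ≤ ∑ k ∈ s, |v k| := Finset.sum_nonneg fun _ _ => abs_nonneg _
      nlinarith [abs_nonneg (v k), mul_nonneg (abs_nonneg (v k)) h0]
  linarith [h Finset.univ]

/-- The coefficient of `(x - y)^i` in the Taylor polynomial of `f` at `y`. -/
noncomputable def taylorCoeff {d : ℕ} (f : Vec d → ℝ) (i : Fin d → ℕ) (y : Fin d → ℝ) : ℝ :=
  multiDeriv i f (WithLp.toLp 2 y) / ∏ k, (Nat.factorial (i k) : ℝ)

namespace IsHolder

variable {d : ℕ} {K : ℝ} {f : Vec d → ℝ}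

lemma continuous (hf : IsHolder (d + 1) K f) : Continuous f :=
  (hf.contDiff d (by simp)).continuous

lemma continuous_taylorCoeff (hf : IsHolder (d + 1) K f) {i : Fin d → ℕ} (hi : ∑ k, i k ≤ d) :
    Continuous (taylorCoeff f i) := by
  have h : ContDiff ℝ (0 : ℕ) (multiDeriv i f) :=
    contDiff_multiDeriv i (by rw [zero_add]; exact hf.contDiff _ (by omega))
  exact (h.continuous.comp (PiLp.continuous_toLp 2 _)).div_const _

lemma taylor_bound (hf : IsHolder (d + 1) K f) (y u : Fin d → ℝ) :
    |f (WithLp.toLp 2 fun k => y k + u k) - ∑ n ∈ Finset.range (d + 1),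
      ∑ i ∈ Finset.Nat.antidiagonalTuple d n, taylorCoeff f i y * ∏ k, u k ^ i k| ≤
      K * (∑ k, |u k|) ^ (d + 1) := by
  have h := hf.bound (WithLp.toLp 2 fun k => y k + u k) (WithLp.toLp 2 y)
  simp only [taylorSum, add_sub_cancel_left] at h
  refine h.trans ?_
  have := hf.pos.le
  gcongr
  refine (norm_le_sum_abs _).trans (le_of_eq ?_)
  simp

/-- The Taylor bound at the single base point `0` suffices: a polynomial of degree at most `d` plus
a remainder of degree `d + 1`. -/
lemma polyGrowth (hf : IsHolder (d + 1) K f) :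
    PolyGrowth fun z : Fin d → ℝ => f (WithLp.toLp 2 z) := by
  refine ⟨hf.continuous.comp (PiLp.continuous_toLp 2 _),
    (∑ n ∈ Finset.range (d + 1), ∑ i ∈ Finset.Nat.antidiagonalTuple d n, |taylorCoeff f i 0|) + K,
    d + 1, fun z => ?_⟩
  have h := hf.taylor_bound 0 z
  simp only [Pi.zero_apply, zero_add] at h
  have hK := hf.pos.le
  have h1 : K * (∑ k, |z k|) ^ (d + 1) ≤ K * ∏ k, (1 + |z k|) ^ (d + 1) := by
    rw [Finset.prod_pow]
    gcongr
    exact sum_abs_le_prod z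
  have h2 : |∑ n ∈ Finset.range (d + 1), ∑ i ∈ Finset.Nat.antidiagonalTuple d n,
      taylorCoeff f i 0 * ∏ k, z k ^ i k| ≤ (∑ n ∈ Finset.range (d + 1),
        ∑ i ∈ Finset.Nat.antidiagonalTuple d n, |taylorCoeff f i 0|) *
        ∏ k, (1 + |z k|) ^ (d + 1) := by
    rw [Finset.sum_mul]
    refine (Finset.abs_sum_le_sum_abs _ _).trans (Finset.sum_le_sum fun n hn => ?_)
    rw [Finset.sum_mul]
    refine (Finset.abs_sum_le_sum_abs _ _).trans (Finset.sum_le_sum fun i hi => ?_)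
    rw [abs_mul, Finset.abs_prod]
    gcongr with k
    rw [abs_pow]
    have h3 : i k ≤ d + 1 := by
      rw [Finset.Nat.mem_antidiagonalTuple] at hi
      have := Finset.single_le_sum (fun j _ => Nat.zero_le (i j)) (Finset.mem_univ k)
      have := Finset.mem_range.1 hn
      omega
    calc |z k| ^ i k ≤ (1 + |z k|) ^ i k := by gcongr; linarith
      _ ≤ (1 + |z k|) ^ (d + 1) := pow_le_pow_right₀ (by linarith [abs_nonneg (z k)]) h3
  have h4 := abs_sub_abs_le_abs_sub (f (WithLp.toLp 2 z)) (∑ n ∈ Finset.range (d + 1),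
    ∑ i ∈ Finset.Nat.antidiagonalTuple d n, taylorCoeff f i 0 * ∏ k, z k ^ i k)
  rw [add_mul]
  linarith

end IsHolder

/-- The coordinatewise truncation of a vector to `[-R, R]`. -/
def truncVec {n : ℕ} (R : ℝ) (z : Fin n → ℝ) : Fin n → ℝ := fun k => max (-R) (min R (z k))

lemma truncVec_eq {n : ℕ} {R : ℝ} {z : Fin n → ℝ} (h : ∀ k, |z k| ≤ R) : truncVec R z = z := by
  funext k
  have := abs_le.1 (h k)
  simp [truncVec, this.1, this.2]

/-- Meant for the Taylor coefficients, whose growth at infinity is not controlled. The evaluation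
points stay almost surely in a bounded box, so truncation to that box makes the coefficients bounded
without changing the integrals. -/
lemma polyGrowth_comp_truncVec {n : ℕ} {R : ℝ} (hR : 0 ≤ R) {F : (Fin n → ℝ) → ℝ}
    (hF : Continuous F) : PolyGrowth fun z => F (truncVec R z) := by
  obtain ⟨K, hK⟩ := (isCompact_Icc (a := fun _ : Fin n => -R)
    (b := fun _ : Fin n => R)).exists_bound_of_continuousOn hF.continuousOn
  refine ⟨hF.comp (by unfold truncVec; fun_prop), K, 0, fun z => ?_⟩
  simp only [pow_zero, Finset.prod_const_one, mul_one]
  refine hK _ ⟨fun k => le_max_left _ _, fun k => max_le (by linarith) (min_le_left _ _)⟩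

/-! ### The law of one point of the sample with its noise -/

/-- The pairs formed by a point of a sample and its noise have the product law. -/
lemma IsSample.map_eq {Ω : Type u} [MeasurableSpace Ω] {P : Measure Ω} [IsProbabilityMeasure P]
    {d N : ℕ} {ν τ : Fin d → Measure ℝ} [∀ k, IsProbabilityMeasure (ν k)]
    [∀ k, IsProbabilityMeasure (τ k)] {X V : Fin N → Fin d → Ω → ℝ}
    (h : IsSample P ν τ X V) (i : Fin N) :
    P.map (fun ω k => (X i k ω, V i k ω)) = Measure.pi fun k => (ν k).prod (τ k) := by
  let ξ : Fin d ⊕ Fin d → Ω → ℝ := Sum.elim (X i) (V i)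
  let Ψ : (Fin d → ℝ × ℝ) → (Fin d ⊕ Fin d → ℝ) := fun a =>
    Sum.elim (fun k => (a k).1) (fun k => (a k).2)
  let Φ : (Fin d ⊕ Fin d → ℝ) → (Fin d → ℝ × ℝ) := fun y k => (y (Sum.inl k), y (Sum.inr k))
  have hΦ : Measurable Φ := by unfold Φ; fun_prop
  have hΨ : Measurable Ψ := by
    refine measurable_pi_lambda _ fun j => ?_
    rcases j with k | k
    · exact (measurable_pi_apply k).fst
    · exact (measurable_pi_apply k).snd
  have hξm : ∀ j, AEMeasurable (ξ j) P := by
    rintro (k | k)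
    · exact (h.lawX i k).aemeasurable
    · exact (h.lawV i k).aemeasurable
  have hξ : iIndepFun ξ P := by
    have hinj : Function.Injective (Sum.map (Prod.mk i) (Prod.mk i) :
        Fin d ⊕ Fin d → (Fin N × Fin d) ⊕ (Fin N × Fin d)) :=
      Sum.map_injective.2 ⟨Prod.mk_right_injective i, Prod.mk_right_injective i⟩
    refine (iIndepFun_congr fun j => ?_).1 (h.indep.precomp hinj)
    rcases j with k | k <;> exact Filter.EventuallyEq.rfl
  have h1 : P.map (fun ω j => ξ j ω) = Measure.pi (Sum.elim ν τ) := by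
    rw [hξ.map_fun_eq_pi_map hξm]
    congr 1
    funext j
    rcases j with k | k
    · exact (h.lawX i k).map_eq
    · exact (h.lawV i k).map_eq
  have : ∀ j, SigmaFinite ((Sum.elim ν τ : Fin d ⊕ Fin d → Measure ℝ) j) := by
    rintro (k | k) <;> simp only [Sum.elim_inl, Sum.elim_inr] <;> infer_instance
  -- Independence gives a product over the `2d` separate coordinates. Rectangles show that `Ψ`
  -- carries the product of pairs to it, and `Φ` inverts `Ψ`.
  have h2 : (Measure.pi fun k => (ν k).prod (τ k)).map Ψ = Measure.pi (Sum.elim ν τ) := by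
    refine (Measure.pi_eq fun s hs => ?_).symm
    rw [Measure.map_apply hΨ (MeasurableSet.univ_pi hs)]
    have h3 : Ψ ⁻¹' Set.univ.pi s =
        Set.univ.pi fun k => s (Sum.inl k) ×ˢ s (Sum.inr k) := by
      ext a
      simp only [Ψ, Set.mem_preimage, Set.mem_pi, Set.mem_univ, true_imp_iff, Sum.forall,
        Sum.elim_inl, Sum.elim_inr, Set.mem_prod]
      exact forall_and.symm
    rw [h3, Measure.pi_pi]
    simp [Measure.prod_prod, Finset.prod_mul_distrib]
  have h4 : (fun ω k => (X i k ω, V i k ω)) = Φ ∘ fun ω j => ξ j ω := rfl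
  have h5 : Φ ∘ Ψ = id := rfl
  rw [h4, ← AEMeasurable.map_map_of_aemeasurable hΦ.aemeasurable (aemeasurable_pi_lambda _ hξm),
    h1, ← h2, Measure.map_map hΦ hΨ, h5, Measure.map_id]

/-! ### ANOVA components and the moments that produce them -/

/-- The weight of one coordinate after integration by parts and tilting of the noise. -/
noncomputable def triWeight (s : Bool) (b σ x : ℝ) (ω : ℝ × ℝ × ℝ) : ℝ :=
  pointWeight s b x ω.1 * noiseWeight s σ ω.2

/-- The component of `f` indexed by `w` in its ANOVA decomposition anchored at `x`. -/
noncomputable def anovaTerm {d : ℕ} (f : Vec d → ℝ) (ν : Fin d → Measure ℝ) (x : Vec d)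
    (w : Finset (Fin d)) : ℝ :=
  ∫ z, f (WithLp.toLp 2 z) * ∏ k, pointWeight (decide (k ∈ w)) 1 (x k) (z k)
    ∂(Measure.pi fun k => mixLaw (ν k) (x k))

lemma pointWeight_eq_mul (s : Bool) (b x z : ℝ) :
    pointWeight s b x z = (if s then b else 1) * pointWeight s 1 x z := by
  unfold pointWeight
  cases s <;> split_ifs <;> (simp_all; try ring)

section

variable {d : ℕ} {ρ σ K : ℝ} {I : Fin d → Set ℝ} {g : Fin d → ℝ → ℝ} {ν τ : Fin d → Measure ℝ}
  {x : Vec d} {M : Vec d → ℝ}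

lemma anovaTerm_empty (hν : ∀ k, IsInputLaw ρ (I k) (g k) (ν k)) (hx : ∀ k, x k ∈ I k)
    (hM : PolyGrowth fun z : Fin d → ℝ => M (WithLp.toLp 2 z)) :
    anovaTerm M ν x ∅ = ∫ z, M (WithLp.toLp 2 z) ∂(Measure.pi ν) := by
  have := fun k => (hν k).prob
  have h := integral_pi_replace (fun k => mixLaw (ν k) (x k)) ν (fun _ z => z)
    (fun k z => pointWeight false 1 (x k) z) (fun _ z => z) (fun _ _ => 1)
    (fun k => ((hν k).allMoments_id (hx k)).mixLaw _) (fun k => allMoments_pointWeight _ _ _)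
    (fun k => (hν k).allMoments_id (hx k)) (fun k => .const _)
    (fun k f hf => by
      rw [integral_mul_pointWeight ((hν k).measure_singleton _)
        (hf.allMoments ((hν k).allMoments_id (hx k))).integrable]
      simp) _ hM
  simpa [anovaTerm] using h

/-- In each coordinate the two weights stand for `δ_x - ν` and `ν`, whose sum is `δ_x`. Expanding
the product of these sums over subsets yields the components. -/
lemma sum_anovaTerm (hν : ∀ k, IsInputLaw ρ (I k) (g k) (ν k)) (hx : ∀ k, x k ∈ I k)
    (hM : PolyGrowth fun z : Fin d → ℝ => M (WithLp.toLp 2 z)) :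
    ∑ w : Finset (Fin d), anovaTerm M ν x w = M x := by
  have := fun k => (hν k).prob
  have hX := fun k => (hν k).allMoments_id (hx k)
  have h := integral_pi_replace (fun k => mixLaw (ν k) (x k)) ν (fun _ z => z)
    (fun k z => pointWeight true 1 (x k) z + pointWeight false 1 (x k) z)
    (fun k _ => x k) (fun _ _ => 1)
    (fun k => (hX k).mixLaw _)
    (fun k => (allMoments_pointWeight _ _ _).add (allMoments_pointWeight _ _ _))
    (fun k => .const _) (fun k => .const _)
    (fun k f hf => by
      have hf' := hf.allMoments (hX k)
      have hi := fun s => ((hf'.mixLaw (x k)).mul (allMoments_pointWeight s 1 (x k))).integrable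
      simp only [mul_add]
      rw [integral_add (hi true) (hi false),
        integral_mul_pointWeight ((hν k).measure_singleton _) hf'.integrable,
        integral_mul_pointWeight ((hν k).measure_singleton _) hf'.integrable]
      simp) _ hM
  have h1 : ∀ z : Fin d → ℝ, ∏ k, (pointWeight true 1 (x k) (z k) +
      pointWeight false 1 (x k) (z k)) =
      ∑ w : Finset (Fin d), ∏ k, pointWeight (decide (k ∈ w)) 1 (x k) (z k) := by
    intro z
    rw [Finset.prod_add, Finset.powerset_univ]
    refine Finset.sum_congr rfl fun w _ => ?_
    rw [← Finset.prod_mul_prod_compl w, Finset.compl_eq_univ_sdiff]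
    congr 1 <;> refine Finset.prod_congr rfl fun k hk => ?_
    · simp [hk]
    · simp [(Finset.mem_sdiff.1 hk).2]
  simp only [h1, Finset.mul_sum] at h
  rw [integral_finsetSum] at h
  · simpa [anovaTerm] using h
  · intro w _
    exact ((hM.allMoments fun k => allMoments_pi (μ := fun k => mixLaw (ν k) (x k)) (k := k)
      (p := fun z => z) ((hX k).mixLaw (x k))).mul
      (AllMoments.prod _ fun k _ => allMoments_pi (μ := fun k => mixLaw (ν k) (x k))
        (p := pointWeight (decide (k ∈ w)) 1 (x k)) (allMoments_pointWeight _ _ _))).integrable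

lemma centered_eq_sum (hν : ∀ k, IsInputLaw ρ (I k) (g k) (ν k)) (hx : ∀ k, x k ∈ I k)
    (hM : PolyGrowth fun z : Fin d → ℝ => M (WithLp.toLp 2 z)) :
    centered M ν x = ∑ p ∈ Finset.Icc 1 d, ∑ w ∈ Finset.powersetCard p Finset.univ,
      anovaTerm M ν x w := by
  have h := sum_anovaTerm hν hx hM
  rw [← Finset.powerset_univ, Finset.sum_powerset, Finset.card_univ, Fintype.card_fin,
    Finset.sum_range_succ', Finset.powersetCard_zero, Finset.sum_singleton,
    anovaTerm_empty hν hx hM] at h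
  rw [centered, ← h, add_sub_cancel_right, Finset.range_eq_Ico,
    Finset.sum_Ico_add' (fun p => ∑ w ∈ Finset.powersetCard p Finset.univ, anovaTerm M ν x w),
    zero_add]
  rfl

lemma allMoments_triWeight {ν τ : Measure ℝ} [IsProbabilityMeasure ν] (hτ : IsNoiseLaw σ τ)
    (s : Bool) (b x : ℝ) : AllMoments (triWeight s b σ x) (triLaw ν τ x) := by
  have := hτ.prob
  exact (allMoments_fst (allMoments_pointWeight s b x)).mul
    (allMoments_snd (hτ.allMoments_noiseWeight s))

lemma allMoments_triLaw_fst {ρ x : ℝ} {I : Set ℝ} {g : ℝ → ℝ} {ν τ : Measure ℝ}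
    (hν : IsInputLaw ρ I g ν) (hx : x ∈ I) [IsProbabilityMeasure τ] :
    AllMoments (fun ω : ℝ × ℝ × ℝ => ω.1) (triLaw ν τ x) := by
  have := hν.prob
  exact allMoments_fst ((hν.allMoments_id hx).mixLaw x)

lemma allMoments_triLaw_effNoise {ν τ : Measure ℝ} {x : ℝ} [IsProbabilityMeasure ν]
    (hτ : IsNoiseLaw σ τ) (s : Bool) :
    AllMoments (fun ω : ℝ × ℝ × ℝ => effNoise s ω.2) (triLaw ν τ x) := by
  have := hτ.prob
  exact allMoments_snd (hτ.allMoments_effNoise s)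

lemma ae_abs_le_mixLaw {ρ x : ℝ} {I : Set ℝ} {g : ℝ → ℝ} {ν : Measure ℝ}
    (hν : IsInputLaw ρ I g ν) (hx : x ∈ I) :
    ∀ᵐ z ∂(mixLaw ν x), |z| ≤ |x| + 1 / ρ := by
  have h1 : 0 ≤ 1 / ρ := by have := hν.rho_pos; positivity
  rw [mixLaw, ae_add_measure_iff]
  refine ⟨Measure.ae_smul_measure (hν.ae_mem.mono fun z hz => hν.abs_le hx hz) _,
    Measure.ae_smul_measure ?_ _⟩
  rw [ae_dirac_eq]
  simpa using hν.rho_pos.le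

lemma ae_abs_le_pi (hν : ∀ k, IsInputLaw ρ (I k) (g k) (ν k)) (hx : ∀ k, x k ∈ I k)
    [∀ k, IsProbabilityMeasure (τ k)] :
    ∀ᵐ ω ∂(Measure.pi fun k => triLaw (ν k) (τ k) (x k)), ∀ k, |(ω k).1| ≤ ‖x‖ + 1 / ρ := by
  have := fun k => (hν k).prob
  rw [ae_all_iff]
  intro k
  have h1 : ∀ᵐ a ∂(triLaw (ν k) (τ k) (x k)), |a.1| ≤ |x k| + 1 / ρ :=
    Measure.quasiMeasurePreserving_fst.ae (ae_abs_le_mixLaw (hν k) (hx k))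
  filter_upwards [(measurePreserving_eval (fun k => triLaw (ν k) (τ k) (x k))
    k).quasiMeasurePreserving.ae h1] with ω hω
  exact hω.trans (add_le_add_left (PiLp.norm_apply_le x k) _)

/-- The main part: after integration of the noise, the weights produce an ANOVA component. -/
lemma integral_triWeight (hν : ∀ k, IsInputLaw ρ (I k) (g k) (ν k)) (hx : ∀ k, x k ∈ I k)
    (hσ : 0 < σ) (hτ : ∀ k, IsNoiseLaw σ (τ k))
    (hM : PolyGrowth fun z : Fin d → ℝ => M (WithLp.toLp 2 z)) (b : ℝ) (w : Finset (Fin d)) :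
    ∫ ω, M (WithLp.toLp 2 fun k => (ω k).1) * ∏ k, triWeight (decide (k ∈ w)) b σ (x k) (ω k)
      ∂(Measure.pi fun k => triLaw (ν k) (τ k) (x k)) = b ^ w.card * anovaTerm M ν x w := by
  have := fun k => (hν k).prob
  have := fun k => (hτ k).prob
  rw [integral_pi_replace (fun k => triLaw (ν k) (τ k) (x k)) (fun k => mixLaw (ν k) (x k))
    (fun _ ω => ω.1) (fun k => triWeight (decide (k ∈ w)) b σ (x k)) (fun _ z => z)
    (fun k => pointWeight (decide (k ∈ w)) b (x k))
    (fun k => allMoments_triLaw_fst (hν k) (hx k)) (fun k => allMoments_triWeight (hτ k) _ _ _)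
    (fun k => ((hν k).allMoments_id (hx k)).mixLaw _) (fun k => allMoments_pointWeight _ _ _)
    (fun k f hf => by
      have h := integral_triLaw (ν := ν k) (τ := τ k) (x := x k)
        (fun z => f z * pointWeight (decide (k ∈ w)) b (x k) z) (noiseWeight (decide (k ∈ w)) σ)
      rw [(hτ k).integral_noiseWeight hσ, mul_one] at h
      simpa only [triWeight, mul_assoc] using h) _ hM, anovaTerm, ← integral_const_mul]
  congr 1
  funext z
  simp only [pointWeight_eq_mul _ b, Finset.prod_mul_distrib]
  simp only [decide_eq_true_eq, Finset.prod_ite_mem, Finset.univ_inter, Finset.prod_const]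
  ring

/-- A first power of the effective noise integrates to zero. -/
lemma integral_effNoise_mul_triWeight_eq_zero (hν : ∀ k, IsInputLaw ρ (I k) (g k) (ν k))
    (hx : ∀ k, x k ∈ I k) (hτ : ∀ k, IsNoiseLaw σ (τ k)) {F : (Fin d → ℝ) → ℝ}
    (hF : PolyGrowth F) (b : ℝ) (s : Fin d → Bool) (e : Fin d → ℕ) {j : Fin d} (hj : e j = 1) :
    ∫ ω, F (fun k => (ω k).1) *
      ∏ k, (effNoise (s k) (ω k).2 ^ e k * triWeight (s k) b σ (x k) (ω k))
      ∂(Measure.pi fun k => triLaw (ν k) (τ k) (x k)) = 0 := by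
  have := fun k => (hν k).prob
  have := fun k => (hτ k).prob
  have hW : ∀ k, AllMoments (fun ω : ℝ × ℝ × ℝ =>
      effNoise (s k) ω.2 ^ e k * triWeight (s k) b σ (x k) ω) (triLaw (ν k) (τ k) (x k)) :=
    fun k => ((allMoments_triLaw_effNoise (hτ k) _).pow _).mul (allMoments_triWeight (hτ k) _ _ _)
  -- The weight of coordinate `j` is replaced by `0`: the test function sees only the evaluation
  -- point, so the centred effective noise factors out there. The whole product then vanishes.
  rw [integral_pi_replace (fun k => triLaw (ν k) (τ k) (x k))
    (fun k => triLaw (ν k) (τ k) (x k))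
    (fun _ ω => ω.1) (fun k ω => effNoise (s k) ω.2 ^ e k * triWeight (s k) b σ (x k) ω)
    (fun _ ω => ω.1) (fun k ω => if k = j then 0 else
      effNoise (s k) ω.2 ^ e k * triWeight (s k) b σ (x k) ω)
    (fun k => allMoments_triLaw_fst (hν k) (hx k)) hW
    (fun k => allMoments_triLaw_fst (hν k) (hx k))
    (fun k => by
      by_cases h : k = j
      · simpa only [h, if_true] using AllMoments.const 0
      · simpa only [h, if_false] using hW k)
    (fun k f hf => by
      by_cases h : k = j
      · subst h
        have h := integral_triLaw (ν := ν k) (τ := τ k) (x := x k)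
          (fun z => f z * pointWeight (s k) b (x k) z)
          fun u => effNoise (s k) u * noiseWeight (s k) σ u
        rw [(hτ k).integral_effNoise, mul_zero] at h
        simp only [if_true, mul_zero, integral_zero, hj, pow_one]
        rw [← h]
        congr 1
        funext ω
        simp only [triWeight]
        ring
      · simp only [h, if_false]) _ hF]
  have h0 : ∀ ω : Fin d → ℝ × ℝ × ℝ, ∏ k, (if k = j then (0 : ℝ) else
      effNoise (s k) (ω k).2 ^ e k * triWeight (s k) b σ (x k) (ω k)) = 0 :=
    fun ω => Finset.prod_eq_zero (Finset.mem_univ j) (by simp)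
  simp [h0]

end

/-! ### Second-order error of a single term -/

section

variable {d : ℕ} {ρ σ K : ℝ} {I : Fin d → Set ℝ} {g : Fin d → ℝ → ℝ} {ν τ : Fin d → Measure ℝ}
  {x : Vec d} {M : Vec d → ℝ}

lemma allMoments_emWeight {I : Set ℝ} {g : ℝ → ℝ} {ν τ : Measure ℝ}
    (hν : IsInputLaw ρ I g ν) (hτ : IsNoiseLaw σ τ) (s : Bool) (h x : ℝ) :
    AllMoments (emWeight s ν g σ h x) (ν.prod τ) := by
  have := hν.prob
  have := hτ.prob
  cases s
  · exact .const 1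
  · convert ((allMoments_fst (hν.allMoments_kernelE x)).const_mul (h * σ ^ 2)⁻¹).mul
      (allMoments_snd hτ.allMoments_id) using 2
    simp [emWeight, div_eq_inv_mul]

/-- One term of the emulator reproduces an ANOVA component up to `O(‖h‖²)`. -/
lemma exists_abs_integral_emWeight_sub_le (hν : ∀ k, IsInputLaw ρ (I k) (g k) (ν k))
    (hx : ∀ k, x k ∈ I k) (hσ : 0 < σ) (hτ : ∀ k, IsNoiseLaw σ (τ k)) (hd : 0 < d)
    (hM : IsHolder (d + 1) K M) (b : ℝ) (w : Finset (Fin d)) :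
    ∃ B : ℝ, ∀ h : Vec d, (∀ k, 0 < h k) → ‖h‖ ≤ 1 →
      |∫ a, M (WithLp.toLp 2 fun k => (a k).1 + b * h k * (a k).2) *
          ∏ k, emWeight (decide (k ∈ w)) (ν k) (g k) σ (h k) (x k) (a k)
          ∂(Measure.pi fun k => (ν k).prod (τ k)) - b ^ w.card * anovaTerm M ν x w| ≤
        B * ‖h‖ ^ 2 := by
  have := fun k => (hν k).prob
  have := fun k => (hτ k).prob
  let s : Fin d → Bool := fun k => decide (k ∈ w)
  let μ : Measure (Fin d → ℝ × ℝ × ℝ) := Measure.pi fun k => triLaw (ν k) (τ k) (x k)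
  let R : ℝ := ‖x‖ + 1 / ρ
  have hR : 0 ≤ R := by have := (hν ⟨0, hd⟩).rho_pos; positivity
  let U : Fin d → (Fin d → ℝ × ℝ × ℝ) → ℝ := fun k ω => effNoise (s k) (ω k).2
  let W : Fin d → (Fin d → ℝ × ℝ × ℝ) → ℝ := fun k ω => triWeight (s k) b σ (x k) (ω k)
  have hA : ∀ k, AllMoments (fun ω : Fin d → ℝ × ℝ × ℝ => (ω k).1) μ := fun k =>
    allMoments_pi (μ := fun k => triLaw (ν k) (τ k) (x k)) (p := fun ω => ω.1)
      (allMoments_triLaw_fst (hν k) (hx k))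
  have hU : ∀ k, AllMoments (U k) μ := fun k =>
    allMoments_pi (μ := fun k => triLaw (ν k) (τ k) (x k)) (p := fun ω => effNoise (s k) ω.2)
      (allMoments_triLaw_effNoise (hτ k) _)
  have hW : ∀ k, AllMoments (W k) μ := fun k =>
    allMoments_pi (μ := fun k => triLaw (ν k) (τ k) (x k)) (p := triWeight (s k) b σ (x k))
      (allMoments_triWeight (hτ k) _ _ _)
  have hWp : AllMoments (fun ω => ∏ k, W k ω) μ := AllMoments.prod _ fun k _ => hW k
  have hMg := hM.polyGrowth
  let D : (Fin d → ℕ) → (Fin d → ℝ) → ℝ := fun i z => taylorCoeff M i (truncVec R z)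
  have hD : ∀ n ∈ Finset.range (d + 1), ∀ i ∈ Finset.Nat.antidiagonalTuple d n,
      PolyGrowth (D i) := by
    intro n hn i hi
    refine polyGrowth_comp_truncVec hR (hM.continuous_taylorCoeff ?_)
    rw [Finset.Nat.mem_antidiagonalTuple.1 hi]
    exact Nat.lt_succ_iff.1 (Finset.mem_range.1 hn)
  have hDA : ∀ᵐ ω ∂μ, ∀ i, D i (fun k => (ω k).1) = taylorCoeff M i fun k => (ω k).1 := by
    filter_upwards [ae_abs_le_pi (τ := τ) hν hx] with ω hω i
    simp only [D]
    rw [truncVec_eq hω]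
  let T : (Fin d → ℕ) → ℝ := fun i =>
    ∫ ω, D i (fun k => (ω k).1) * ∏ k, (U k ω ^ i k * W k ω) ∂μ
  have hT0 : T 0 = b ^ w.card * anovaTerm M ν x w := by
    rw [← integral_triWeight hν hx hσ hτ hMg b w]
    refine integral_congr_ae (hDA.mono fun ω hω => ?_)
    simp only [hω, taylorCoeff, multiDeriv_zero]
    simp [W, s]
  have hT1 : ∀ i ∈ Finset.Nat.antidiagonalTuple d 1, T i = 0 := by
    intro i hi
    obtain ⟨j, hj⟩ : ∃ j, i j = 1 := by
      have h1 := Finset.Nat.mem_antidiagonalTuple.1 hi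
      by_contra! h2
      have h3 : ∀ k, i k = 0 := fun k => by
        have := Finset.single_le_sum (fun j _ => Nat.zero_le (i j)) (Finset.mem_univ k)
        have := h2 k
        omega
      simp [h3] at h1
    exact integral_effNoise_mul_triWeight_eq_zero hν hx hτ
      (hD 1 (by simpa using hd) i hi) b s i hj
  -- An integrable majorant of the Taylor remainder after extraction of `‖h‖ ^ (d + 1)`, hence
  -- independent of `h`.
  let Q : (Fin d → ℝ × ℝ × ℝ) → ℝ := fun ω =>
    K * (|b| * ∑ k, |U k ω|) ^ (d + 1) * |∏ k, W k ω|
  have hQ : Integrable Q μ :=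
    ((((AllMoments.sum _ fun k _ => (hU k).abs).const_mul _).pow _).const_mul _ |>.mul
      hWp.abs).integrable
  -- The remainder plus the Taylor terms of degree `n + 1`. Those with `n = 0` would be of order
  -- `‖h‖` only, but they have `T i = 0`.
  refine ⟨∫ ω, Q ω ∂μ + ∑ n ∈ Finset.range d, ∑ i ∈ Finset.Nat.antidiagonalTuple d (n + 1),
    |b| ^ (n + 1) * |T i|, fun h hh h1 => ?_⟩
  have hhk : ∀ k, |h k| ≤ ‖h‖ := fun k => PiLp.norm_apply_le h k
  let S : (Fin d → ℝ × ℝ × ℝ) → ℝ := fun ω => ∑ n ∈ Finset.range (d + 1),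
    ∑ i ∈ Finset.Nat.antidiagonalTuple d n,
      D i (fun k => (ω k).1) * ∏ k, (b * h k * U k ω) ^ i k
  have hJ : ∫ a, M (WithLp.toLp 2 fun k => (a k).1 + b * h k * (a k).2) *
      ∏ k, emWeight (decide (k ∈ w)) (ν k) (g k) σ (h k) (x k) (a k)
      ∂(Measure.pi fun k => (ν k).prod (τ k)) =
      ∫ ω, M (WithLp.toLp 2 fun k => (ω k).1 + b * h k * U k ω) * ∏ k, W k ω ∂μ :=
    integral_pi_replace (fun k => (ν k).prod (τ k)) (fun k => triLaw (ν k) (τ k) (x k))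
      (fun k a => a.1 + b * h k * a.2)
      (fun k => emWeight (decide (k ∈ w)) (ν k) (g k) σ (h k) (x k))
      (fun k ω => ω.1 + b * h k * effNoise (s k) ω.2) (fun k => triWeight (s k) b σ (x k))
      (fun k => (allMoments_fst ((hν k).allMoments_id (hx k))).add
        ((allMoments_snd (hτ k).allMoments_id).const_mul _))
      (fun k => allMoments_emWeight (hν k) (hτ k) _ _ _)
      (fun k => (allMoments_triLaw_fst (hν k) (hx k)).add
        ((allMoments_triLaw_effNoise (hτ k) _).const_mul _))
      (fun k => allMoments_triWeight (hτ k) _ _ _)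
      (fun k f hf => integral_emWeight (hν k) (hx k) hσ (hτ k) (hh k) b (s k) hf) _ hMg
  have hSi : ∀ n ∈ Finset.range (d + 1), ∀ i ∈ Finset.Nat.antidiagonalTuple d n,
      AllMoments (fun ω => D i (fun k => (ω k).1) * ∏ k, (b * h k * U k ω) ^ i k) μ :=
    fun n hn i hi => ((hD n hn i hi).allMoments hA).mul
      (AllMoments.prod _ fun k _ => ((hU k).const_mul _).pow _)
  have hSW : ∫ ω, S ω * ∏ k, W k ω ∂μ = ∑ n ∈ Finset.range (d + 1),
      ∑ i ∈ Finset.Nat.antidiagonalTuple d n, (∏ k, (b * h k) ^ i k) * T i := by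
    simp only [S, Finset.sum_mul]
    rw [integral_finsetSum _ fun n hn => integrable_finsetSum _ fun i hi =>
      ((hSi n hn i hi).mul hWp).integrable]
    refine Finset.sum_congr rfl fun n hn => ?_
    rw [integral_finsetSum _ fun i hi => ((hSi n hn i hi).mul hWp).integrable]
    refine Finset.sum_congr rfl fun i _ => ?_
    rw [← integral_const_mul]
    congr 1
    funext ω
    simp only [mul_pow, Finset.prod_mul_distrib]
    ring
  have hrem : |∫ ω, M (WithLp.toLp 2 fun k => (ω k).1 + b * h k * U k ω) * ∏ k, W k ω ∂μ -
      ∫ ω, S ω * ∏ k, W k ω ∂μ| ≤ (∫ ω, Q ω ∂μ) * ‖h‖ ^ 2 := by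
    rw [← integral_sub
      ((hMg.allMoments fun k => (hA k).add ((hU k).const_mul _)).mul hWp).integrable
      ((AllMoments.sum _ fun n hn => AllMoments.sum _ fun i hi => hSi n hn i hi).mul
        hWp).integrable, ← integral_mul_const, ← Real.norm_eq_abs]
    refine norm_integral_le_of_norm_le (hQ.mul_const _) (hDA.mono fun ω hω => ?_)
    rw [← sub_mul, Real.norm_eq_abs, abs_mul]
    have h2 := hM.taylor_bound (fun k => (ω k).1) fun k => b * h k * U k ω
    simp only [hω]
    have h3 : K * (∑ k, |b * h k * U k ω|) ^ (d + 1) ≤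
        K * (|b| * ∑ k, |U k ω|) ^ (d + 1) * ‖h‖ ^ 2 := by
      have h4 : ∑ k, |b * h k * U k ω| ≤ (|b| * ∑ k, |U k ω|) * ‖h‖ := by
        rw [Finset.mul_sum, Finset.sum_mul]
        refine Finset.sum_le_sum fun k _ => ?_
        rw [abs_mul, abs_mul, mul_right_comm]
        gcongr
        exact hhk k
      have hK := hM.pos.le
      calc K * (∑ k, |b * h k * U k ω|) ^ (d + 1)
          ≤ K * ((|b| * ∑ k, |U k ω|) * ‖h‖) ^ (d + 1) := by gcongr
        _ = K * (|b| * ∑ k, |U k ω|) ^ (d + 1) * ‖h‖ ^ (d + 1) := by rw [mul_pow]; ring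
        -- As `d ≥ 1`, the exponent `d + 1` is at least `2`, and `‖h‖ ≤ 1`.
        _ ≤ _ := by
          refine mul_le_mul_of_nonneg_left
            (pow_le_pow_of_le_one (norm_nonneg _) h1 (by omega)) (by positivity)
    calc _ ≤ K * (|b| * ∑ k, |U k ω|) ^ (d + 1) * ‖h‖ ^ 2 * |∏ k, W k ω| :=
          mul_le_mul_of_nonneg_right (h2.trans h3) (abs_nonneg _)
      _ = _ := by simp only [Q]; ring
  have hsum : |∫ ω, S ω * ∏ k, W k ω ∂μ - b ^ w.card * anovaTerm M ν x w| ≤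
      (∑ n ∈ Finset.range d, ∑ i ∈ Finset.Nat.antidiagonalTuple d (n + 1),
        |b| ^ (n + 1) * |T i|) * ‖h‖ ^ 2 := by
    rw [hSW, Finset.sum_range_succ', Finset.Nat.antidiagonalTuple_zero_right,
      Finset.sum_singleton, ← hT0]
    simp only [Pi.zero_apply, pow_zero, Finset.prod_const_one, one_mul, add_sub_cancel_right]
    rw [Finset.sum_mul]
    refine (Finset.abs_sum_le_sum_abs _ _).trans (Finset.sum_le_sum fun n _ => ?_)
    rw [Finset.sum_mul]
    refine (Finset.abs_sum_le_sum_abs _ _).trans (Finset.sum_le_sum fun i hi => ?_)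
    rcases Nat.eq_zero_or_pos n with rfl | hn
    · simp [hT1 i hi]
    · rw [abs_mul, Finset.abs_prod, mul_right_comm]
      gcongr
      calc ∏ k, |(b * h k) ^ i k| ≤ ∏ k, (|b| * ‖h‖) ^ i k := by
            refine Finset.prod_le_prod (fun _ _ => abs_nonneg _) fun k _ => ?_
            rw [abs_pow, abs_mul]
            gcongr
            exact hhk k
        _ = |b| ^ (n + 1) * ‖h‖ ^ (n + 1) := by
            rw [Finset.prod_pow_eq_pow_sum, Finset.Nat.mem_antidiagonalTuple.1 hi, mul_pow]
        _ ≤ |b| ^ (n + 1) * ‖h‖ ^ 2 := mul_le_mul_of_nonneg_left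
            (pow_le_pow_of_le_one (norm_nonneg _) h1 (by omega)) (by positivity)
  rw [hJ, add_mul]
  exact (abs_sub_le _ _ _).trans (add_le_add hrem hsum)

end

/-! ### From single terms to the emulator -/

lemma IsCoeff.sum_mul_pow_eq_one {d L rs : ℕ} {β : Fin L → ℝ} {C : ℕ → Fin L → ℝ}
    (hC : IsCoeff d L rs β C) (hL : rs + 2 ≤ L) {p : ℕ} (hp : p ∈ Finset.Icc 1 d) :
    ∑ l, C p l * β l ^ p = 1 := by
  rcases le_or_gt p rs with h | h
  · simpa using hC.low p hp p h
  -- The member `m = 0` of the high family is the exponent `p` itself, available because `L ≥ rs +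
  -- 2`.
  · simpa using hC.high_of_gt p hp h 0 (by omega) p (by simp)

/-- The contribution to the emulator of one point of the sample and its noise. -/
noncomputable def emulatorTerm {d L : ℕ} (M : Vec d → ℝ) (β : Fin L → ℝ) (C : ℕ → Fin L → ℝ)
    (ν : Fin d → Measure ℝ) (g : Fin d → ℝ → ℝ) (σ : ℝ) (h x : Vec d) (a : Fin d → ℝ × ℝ) : ℝ :=
  ∑ l, ∑ p ∈ Finset.Icc 1 d, ∑ w ∈ Finset.powersetCard p Finset.univ,
    C p l * (M (WithLp.toLp 2 fun k => (a k).1 + β l * h k * (a k).2) *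
      ∏ k, emWeight (decide (k ∈ w)) (ν k) (g k) σ (h k) (x k) (a k))

lemma emulator_eq {Ω : Type*} {d L N : ℕ} (M : Vec d → ℝ) (β : Fin L → ℝ) (C : ℕ → Fin L → ℝ)
    (ν : Fin d → Measure ℝ) (g : Fin d → ℝ → ℝ) (σ : ℝ) (h x : Vec d)
    (X V : Fin N → Fin d → Ω → ℝ) (ω : Ω) :
    emulator M β C ν g σ h x X V ω =
      (1 / (N : ℝ)) * ∑ i, emulatorTerm M β C ν g σ h x fun k => (X i k ω, V i k ω) := by
  unfold emulator emulatorTerm elemSymm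
  congr 1
  refine Finset.sum_congr rfl fun i _ => Finset.sum_congr rfl fun l _ =>
    Finset.sum_congr rfl fun p _ => ?_
  rw [Finset.mul_sum]
  refine Finset.sum_congr rfl fun w _ => ?_
  simp only [emWeight, decide_eq_true_eq, Finset.prod_ite_mem, Finset.univ_inter]
  ring

lemma BiasAtMost.mono {d L : ℕ} {M : Vec d → ℝ} {β : Fin L → ℝ} {C : ℕ → Fin L → ℝ}
    {ν τ : Fin d → Measure ℝ} {g : Fin d → ℝ → ℝ} {σ : ℝ} {x h : Vec d} {b b' : ℝ}
    (hb : BiasAtMost.{u} M β C ν τ g σ x h b) (hbb : b ≤ b') :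
    BiasAtMost.{u} M β C ν τ g σ x h b' := fun Ω _ P _ N X V hN hs =>
  ⟨(hb Ω P N X V hN hs).1, (hb Ω P N X V hN hs).2.trans hbb⟩

section

variable {d : ℕ} {ρ σ K : ℝ} {I : Fin d → Set ℝ} {g : Fin d → ℝ → ℝ} {ν τ : Fin d → Measure ℝ}
  {x : Vec d} {M : Vec d → ℝ}

lemma integrable_emWeight (hν : ∀ k, IsInputLaw ρ (I k) (g k) (ν k))
    (hx : ∀ k, x k ∈ I k) (hτ : ∀ k, IsNoiseLaw σ (τ k))
    (hM : IsHolder (d + 1) K M) (b : ℝ) (w : Finset (Fin d)) (h : Vec d) :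
    Integrable (fun a => M (WithLp.toLp 2 fun k => (a k).1 + b * h k * (a k).2) *
      ∏ k, emWeight (decide (k ∈ w)) (ν k) (g k) σ (h k) (x k) (a k))
      (Measure.pi fun k => (ν k).prod (τ k)) := by
  have := fun k => (hν k).prob
  have := fun k => (hτ k).prob
  exact ((hM.polyGrowth.allMoments fun k => allMoments_pi (μ := fun k => (ν k).prod (τ k)) (k := k)
    (p := fun a => a.1 + b * h k * a.2) ((allMoments_fst ((hν k).allMoments_id (hx k))).add
      ((allMoments_snd (hτ k).allMoments_id).const_mul _))).mul
    (AllMoments.prod _ fun k _ => allMoments_pi (μ := fun k => (ν k).prod (τ k)) (k := k)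
      (p := emWeight (decide (k ∈ w)) (ν k) (g k) σ (h k) (x k))
      (allMoments_emWeight (hν k) (hτ k) _ _ _))).integrable

/-- The bias of the emulator is of second order in the bandwidths: averaging over `X'` against the
kernels `E_k` replaces the mixed derivatives of `M` by increments of `M` itself, and the terms of
first order in the remaining noise vanish with its odd moments. -/
theorem exists_biasAtMost_sq {L rs : ℕ} {β : Fin L → ℝ} {C : ℕ → Fin L → ℝ}
    (hν : ∀ k, IsInputLaw ρ (I k) (g k) (ν k))
    (hx : ∀ k, x k ∈ I k) (hσ : 0 < σ) (hτ : ∀ k, IsNoiseLaw σ (τ k)) (hd : 0 < d)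
    (hM : IsHolder (d + 1) K M) (hL : rs + 2 ≤ L) (hC : IsCoeff d L rs β C) :
    ∃ A : ℝ, ∀ h : Vec d, (∀ k, 0 < h k) → ‖h‖ ≤ 1 →
      BiasAtMost.{u} M β C ν τ g σ x h (A * ‖h‖ ^ 2) := by
  have := fun k => (hν k).prob
  have := fun k => (hτ k).prob
  choose B hB using fun (l : Fin L) w =>
    exists_abs_integral_emWeight_sub_le hν hx hσ hτ hd hM (β l) w
  refine ⟨∑ l, ∑ p ∈ Finset.Icc 1 d, ∑ w ∈ Finset.powersetCard p Finset.univ,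
    |C p l| * B l w, fun h hh h1 Ω _ P _ N X V hN hs => ?_⟩
  set m : Measure (Fin d → ℝ × ℝ) := Measure.pi fun k => (ν k).prod (τ k) with hm
  let Y := emulatorTerm M β C ν g σ h x
  have hi := fun l w => integrable_emWeight hν hx hτ hM (β l) w h
  have hYi : Integrable Y m :=
    integrable_finsetSum _ fun l _ => integrable_finsetSum _ fun p _ =>
      integrable_finsetSum _ fun w _ => (hi l w).const_mul _
  let Θ : Fin N → Ω → Fin d → ℝ × ℝ := fun i ω k => (X i k ω, V i k ω)
  have hΘ : ∀ i, AEMeasurable (Θ i) P := fun i => aemeasurable_pi_lambda _ fun k =>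
    (hs.lawX i k).aemeasurable.prodMk (hs.lawV i k).aemeasurable
  have hmap : ∀ i, P.map (Θ i) = m := fun i => hs.map_eq i
  have hYm : ∀ i, AEStronglyMeasurable Y (P.map (Θ i)) := fun i => by
    rw [hmap]; exact hYi.aestronglyMeasurable
  have hYΘ : ∀ i, Integrable (fun ω => Y (Θ i ω)) P := fun i =>
    (integrable_map_measure (hYm i) (hΘ i)).1 (by rw [hmap]; exact hYi)
  have hem : emulator M β C ν g σ h x X V = fun ω => (1 / (N : ℝ)) * ∑ i, Y (Θ i ω) :=
    funext fun ω => emulator_eq M β C ν g σ h x X V ω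
  -- By linearity only the common law of the pairs matters, so the expectation depends neither on
  -- `N` nor on the sample.
  have hint : ∫ ω, emulator M β C ν g σ h x X V ω ∂P = ∫ a, Y a ∂m := by
    have h2 : ∀ i, ∫ ω, Y (Θ i ω) ∂P = ∫ a, Y a ∂m := fun i => by
      rw [← integral_map (hΘ i) (hYm i), hmap]
    rw [hem, integral_const_mul, integral_finsetSum _ fun i _ => hYΘ i]
    simp only [h2, Finset.sum_const, Finset.card_univ, Fintype.card_fin, nsmul_eq_mul]
    rw [← mul_assoc, one_div, inv_mul_cancel₀ (by positivity), one_mul]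
  refine ⟨?_, ?_⟩
  · rw [hem]
    exact (integrable_finsetSum _ fun i _ => hYΘ i).const_mul _
  have hY : ∫ a, Y a ∂m = ∑ l, ∑ p ∈ Finset.Icc 1 d, ∑ w ∈ Finset.powersetCard p Finset.univ,
      C p l * ∫ a, M (WithLp.toLp 2 fun k => (a k).1 + β l * h k * (a k).2) *
        ∏ k, emWeight (decide (k ∈ w)) (ν k) (g k) σ (h k) (x k) (a k) ∂m := by
    simp only [Y, emulatorTerm]
    rw [integral_finsetSum _ fun l _ => integrable_finsetSum _ fun p _ =>
      integrable_finsetSum _ fun w _ => (hi l w).const_mul _]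
    refine Finset.sum_congr rfl fun l _ => ?_
    rw [integral_finsetSum _ fun p _ =>
      integrable_finsetSum _ fun w _ => (hi l w).const_mul _]
    refine Finset.sum_congr rfl fun p _ => ?_
    rw [integral_finsetSum _ fun w _ => (hi l w).const_mul _]
    exact Finset.sum_congr rfl fun w _ => integral_const_mul _ _
  have hc : centered M ν x = ∑ l, ∑ p ∈ Finset.Icc 1 d,
      ∑ w ∈ Finset.powersetCard p Finset.univ, C p l * (β l ^ w.card * anovaTerm M ν x w) := by
    rw [centered_eq_sum hν hx hM.polyGrowth, Finset.sum_comm]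
    refine Finset.sum_congr rfl fun p hp => ?_
    rw [Finset.sum_comm]
    refine Finset.sum_congr rfl fun w hw => ?_
    rw [(Finset.mem_powersetCard.1 hw).2]
    simp only [← mul_assoc]
    rw [← Finset.sum_mul, hC.sum_mul_pow_eq_one hL hp, one_mul]
  rw [hint, hY, hc]
  simp only [← Finset.sum_sub_distrib, ← mul_sub, Finset.sum_mul]
  refine (Finset.abs_sum_le_sum_abs _ _).trans (Finset.sum_le_sum fun l _ => ?_)
  refine (Finset.abs_sum_le_sum_abs _ _).trans (Finset.sum_le_sum fun p _ => ?_)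
  refine (Finset.abs_sum_le_sum_abs _ _).trans (Finset.sum_le_sum fun w _ => ?_)
  rw [abs_mul, mul_assoc]
  exact mul_le_mul_of_nonneg_left (hB l w h hh h1) (abs_nonneg _)

end

lemma Kconst_nonneg (d : ℕ) : 0 ≤ Kconst d := by
  refine Real.sInf_nonneg ?_
  rintro v ⟨μ, -, -, rfl⟩
  exact integral_nonneg fun z => mul_nonneg (norm_nonneg _)
    (Finset.prod_nonneg fun k _ => sq_nonneg _)

lemma Gam_nonneg {L : ℕ} (C : ℕ → Fin L → ℝ) (β : Fin L → ℝ) (p r : ℕ) : 0 ≤ Gam C β p r :=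
  Finset.sum_nonneg fun _ _ => abs_nonneg _

lemma meanAbsE_nonneg (ν : Measure ℝ) (g : ℝ → ℝ) (t : ℝ) : 0 ≤ meanAbsE ν g t :=
  integral_nonneg fun _ => abs_nonneg _

lemma eventually_bandwidths (d : ℕ) : ∀ᶠ h in bandwidths d, (∀ k, 0 < h k) ∧ ‖h‖ ≤ 1 := by
  refine Filter.Eventually.and eventually_mem_nhdsWithin (mem_nhdsWithin_of_mem_nhds ?_)
  filter_upwards [Metric.closedBall_mem_nhds (0 : Vec d) one_pos] with h hh
  simpa using hh

end DbAnova

/-! ### Deducing the three bounds -/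

theorem mainTheorem8 (d L rs : ℕ) (hd : 0 < d) (hrs : rs ≤ d - 1) (hL : L = rs + 2)
    (β : Fin L → ℝ) (hβ : Function.Injective β)
    (C : ℕ → Fin L → ℝ) (hC : DbAnova.IsCoeff d L rs β C)
    (ρmin : ℝ) (I : Fin d → Set ℝ) (g : Fin d → ℝ → ℝ) (ν : Fin d → MeasureTheory.Measure ℝ)
    (hν : ∀ k, DbAnova.IsInputLaw ρmin (I k) (g k) (ν k))
    (σ : ℝ) (hσ : 0 < σ) (τ : Fin d → MeasureTheory.Measure ℝ)
    (hτ : ∀ k, DbAnova.IsNoiseLaw σ (τ k))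
    (M : DbAnova.Vec d → ℝ) (Md1 : ℝ) (hM : DbAnova.IsHolder (d + 1) Md1 M)
    (x : DbAnova.Vec d) (hx : ∀ k, x k ∈ I k) :
    -- the expectations in the bounds are finite
    MeasureTheory.Integrable (fun y => M (WithLp.toLp 2 y)) (MeasureTheory.Measure.pi ν) ∧
    (∀ k, MeasureTheory.Integrable (DbAnova.kernelE (ν k) (g k) (x k)) (ν k)) ∧
    -- general `V`
    (∃ A : ℝ, ∀ᶠ h in DbAnova.bandwidths d,
      DbAnova.BiasAtMost.{u} M β C ν τ g σ x h
        (σ * ‖h‖ * Md1 * DbAnova.Kconst d * DbAnova.Gam C β d (d + 1) *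
          (∏ k, DbAnova.meanAbsE (ν k) (g k) (x k)) + A * ‖h‖ ^ 2)) ∧
    -- uniform `V`
    (∀ ξ : ℝ, 0 < ξ → (∀ k, τ k = ProbabilityTheory.cond MeasureTheory.volume (Set.Ioo (-ξ) ξ)) →
      (∃ A : ℝ, ∀ᶠ h in DbAnova.bandwidths d,
        DbAnova.BiasAtMost.{u} M β C ν τ g σ x h
          (ξ * (∑ k, |h k|) * Md1 * DbAnova.Gam C β d (d + 1) *
            (∏ k, DbAnova.meanAbsE (ν k) (g k) (x k)) + A * (∑ k, |h k|) ^ 2)) ∧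
      -- uniform bandwidth
      (ξ ≤ 1 / (d * Md1 * DbAnova.Gam C β d (d + 1) *
            ∏ k, DbAnova.meanAbsE (ν k) (g k) (x k)) →
        ∀ᶠ η in nhdsWithin (0 : ℝ) (Set.Ioi 0),
          DbAnova.BiasAtMost.{u} M β C ν τ g σ x (WithLp.toLp 2 (fun _ => η)) η)) := by
  have := fun k => (hν k).prob
  obtain ⟨A, hA⟩ := DbAnova.exists_biasAtMost_sq.{u} hν hx hσ hτ hd hM hL.ge hC
  have hev := DbAnova.eventually_bandwidths d
  have hMd := hM.pos.le
  have hK := DbAnova.Kconst_nonneg d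
  have hG := DbAnova.Gam_nonneg C β d (d + 1)
  have hE : 0 ≤ ∏ k, DbAnova.meanAbsE (ν k) (g k) (x k) :=
    Finset.prod_nonneg fun k _ => DbAnova.meanAbsE_nonneg _ _ _
  refine ⟨?_, fun k => ((hν k).allMoments_kernelE (x k)).integrable, ⟨A, ?_⟩,
    fun ξ hξ _ => ⟨⟨|A|, ?_⟩, fun _ => ?_⟩⟩
  · exact (hM.polyGrowth.allMoments fun k => DbAnova.allMoments_pi (μ := ν) (k := k)
      (p := fun z => z) ((hν k).allMoments_id (hx k))).integrable
  · filter_upwards [hev] with h hh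
    -- The quadratic bound holds alone; the nonnegative linear term is added on top.
    exact (hA h hh.1 hh.2).mono (le_add_of_nonneg_left (by positivity))
  · filter_upwards [hev] with h hh
    refine (hA h hh.1 hh.2).mono ?_
    -- Passing from `‖h‖` to the larger `‖h‖₁` requires a nonnegative coefficient, hence `|A|`.
    have h1 : A * ‖h‖ ^ 2 ≤ |A| * (∑ k, |h k|) ^ 2 := by
      gcongr
      · exact le_abs_self A
      · exact DbAnova.norm_le_sum_abs h
    have h2 : 0 ≤ ∑ k, |h k| := Finset.sum_nonneg fun _ _ => abs_nonneg _
    exact h1.trans (le_add_of_nonneg_left (by positivity))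
  · have hd0 : (0 : ℝ) < d := by exact_mod_cast hd
    have hnorm : ∀ η : ℝ, ‖(WithLp.toLp 2 (fun _ => η) : DbAnova.Vec d)‖ ^ 2 = d * η ^ 2 := by
      intro η
      simp [EuclideanSpace.norm_sq_eq]
    -- Below this threshold `d η² (|A| + 1) ≤ η`. The part with `|A|` bounds the bias by `η`; the
    -- added `1`, together with `η < 1`, gives `‖h‖² = d η² ≤ 1`.
    have hA1 : 0 < 1 / (d * (|A| + 1)) := by positivity
    filter_upwards [Ioo_mem_nhdsGT (lt_min one_pos hA1),
      self_mem_nhdsWithin] with η hη hη0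
    have hη1 := hη.2.trans_le (min_le_right _ _)
    have hη2 := hη.2.trans_le (min_le_left _ _)
    have hη0 : 0 < η := hη0
    rw [lt_div_iff₀ (by positivity)] at hη1
    have hb : d * η ^ 2 * (|A| + 1) ≤ η := by nlinarith
    have hd2 : d * η ^ 2 ≤ 1 := by
      have : 0 ≤ d * η ^ 2 * |A| := by positivity
      linarith
    refine (hA _ (fun k => hη0) ?_).mono ?_
    · rw [← sq_le_one_iff₀ (norm_nonneg _), hnorm]
      exact hd2
    · rw [hnorm]
      have h1 : A * (d * η ^ 2) ≤ |A| * (d * η ^ 2) := by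
        gcongr
        exact le_abs_self A
      have h2 : 0 ≤ d * η ^ 2 := by positivity
      linarith
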